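/- Let $\mathbb K\in\{\mathbb R,\mathbb C\}$, $T^2=\{(x,y):0\le x,\ 0\le y\le 1-x\}$, and let $K$ be a kernel such that $(x,y)\mapsto K(1-x,y)$ lies in $L^2(T^2)$ (equivalently, $K\in L^2(\{0\le y\le x\le 1\})$). Let $\mathcal V_K$ be the Volterra operator with limits $0$ to $x$, $(\mathcal V_Ku)(x)=\int_0^xK(x,y)u(y)\,dy$. Let $\tilde P^{(a,b)}_n$ be the Jacobi polynomials in the standard normalization, shifted to $[0,1]$ (orthogonal for $(1-x)^ax^b\,dx$). On $T^2$ use the basis $P_{k,n}(x,y)=(1-x)^k\tilde P^{(2k+1,0)}_{n-k}(x)\,\tilde P^{(0,0)}_k\!\big(\tfrac{y}{1-x}\big)$, $0\le k\le n$. On coefficient sequences with respect to these polynomials (indices from $0$) let * $\mathrm E_y$ represent $u(\cdot)\mapsto\big((x,y)\mapsto u(y)\big)$, from the $\tilde P^{(1,0)}$ basis to the triangle basis: $(\mathrm E_yu)_{n,k}=\frac{(-1)^{n+k}(2k+1)}{n+1}u_n$; * $K(1-\mathrm J_x,\mathrm J_y)$ represent multiplication by $K(1-x,y)$ on $T^2$;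 * $(\mathrm Q_yf)_n=f_{n,0}$, i.e. $\mathrm Q_y$ represents $f\mapsto\frac1{1-x}\int_0^{1-x}f(x,y)\,dy$, with output in the $\tilde P^{(1,0)}$ basis; * $\mathrm L=\mathrm L_{(1,0)}^{(0,0)}$ represent multiplication by $1-x$ from the $\tilde P^{(1,0)}$ basis to the $\tilde P^{(0,0)}$ basis, $\mathrm R$ the reflection $x\mapsto 1-x$ in the $\tilde P^{(0,0)}$ basis, and $\mathrm S=\mathrm S_{(0,0)}^{(1,0)}$ the conversion from the $\tilde P^{(0,0)}$ basis to the $\tilde P^{(1,0)}$ basis. Below, elements of $\ell^2$ are the coefficient sequences with respect to the *normalized* polynomials $\tilde P^{(a,b)}_n/\|\tilde P^{(a,b)}_n\|_{L^2((1-x)^ax^bdx)}$, and the operators are transported to them by the corresponding diagonal rescaling. Then: 1. The analysis operator $\mathcal E:L^2((0,1),(1-x)dx)\to\ell^2$ of the $\tilde P^{(1,0)}$ basis is an isometric isomorphism, $\mathcal V_K$ is a bounded operator on $L^2((0,1),(1-x)dx)$, and the coefficient-space Volterra operator $\mathrm V_K=\mathcal E\,\mathcal V_K\,\mathcal E^{-1}:\ell^2\to\ell^2$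 is compact and has the form $$\mathrm V_K=\mathrm S\,\mathrm R\,\mathrm L\,\mathrm Q_y\,K(1-\mathrm J_x,\mathrm J_y)\,\mathrm E_y .$$ 2. The product $\mathrm L\,\mathrm Q_y\,K(1-\mathrm J_x,\mathrm J_y)\,\mathrm E_y$ itself (without the reflection and the return to the $\tilde P^{(1,0)}$ basis), applied to the $\tilde P^{(1,0)}$ coefficients of $u\in L^2(0,1)$ and with output in the $\tilde P^{(0,0)}$ basis, defines a compact operator $L^2(0,1)\to\ell^2$. 3. If moreover $\iint_{T^2}\frac{|K(1-x,y)|^2}{1-y}\,dx\,dy<\infty$ (for example, if $K$ is bounded), then $\mathrm L\,\mathrm Q_y\,K(1-\mathrm J_x,\mathrm J_y)\,\mathrm E_y$ is a compact operator from $\ell^2$ (coefficients in the $\tilde P^{(1,0)}$ basis) to $\ell^2$ (coefficients in the $\tilde P^{(0,0)}$ basis). -/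

import Mathlib

open MeasureTheory Set
open scoped ENNReal

noncomputable section

namespace VolterraJacobi

variable {𝕜 : Type*} [RCLike 𝕜]

/-- The Jacobi polynomial `P_n^{(a,b)}` (natural parameters, standard normalization
`P_n^{(a,b)}(1) = binom(n+a, n)`), shifted to `[0,1]`, i.e. evaluated at `2x - 1`. -/
def jacobiP (a b n : ℕ) (x : ℝ) : ℝ :=
  ∑ s ∈ Finset.range (n + 1),
    ((n + a).choose (n - s) : ℝ) * ((n + b).choose s : ℝ) * (x - 1) ^ s * x ^ (n - s)

/-- The Jacobi weight `(1-x)^a x^b`. -/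
def jacobiWeight (a b : ℕ) (x : ℝ) : ℝ := (1 - x) ^ a * x ^ b

/-- The measure `(1-x)^a x^b dx` on `(0,1)`. -/
def jacobiMeasure (a b : ℕ) : Measure ℝ :=
  (volume.restrict (Ioo (0 : ℝ) 1)).withDensity (fun x => ENNReal.ofReal (jacobiWeight a b x))

/-- The norm of the shifted Jacobi polynomial in `L²((1-x)^a x^b dx)`. -/
def jacobiNorm (a b n : ℕ) : ℝ :=
  √(∫ x in Ioo (0 : ℝ) 1, jacobiWeight a b x * jacobiP a b n x ^ 2)

/-- The `n`-th coefficient of `f` in the (unnormalized) shifted Jacobi basis. -/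
def jacobiCoeff (a b : ℕ) (f : ℝ → 𝕜) (n : ℕ) : 𝕜 :=
  ((jacobiNorm a b n ^ 2)⁻¹ : ℝ) •
    ∫ x in Ioo (0 : ℝ) 1, (jacobiWeight a b x * jacobiP a b n x) • f x

/-- From coefficients with respect to the normalized polynomials `P_n / ‖P_n‖` to coefficients
with respect to the polynomials `P_n`: `∑ c_n (P_n / ‖P_n‖) = ∑ (c_n / ‖P_n‖) P_n`. -/
def unnormalize (a b : ℕ) (c : ℕ → 𝕜) (n : ℕ) : 𝕜 := ((jacobiNorm a b n)⁻¹ : ℝ) • c n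

/-- From coefficients with respect to the polynomials `P_n` to coefficients with respect to the
normalized polynomials `P_n / ‖P_n‖`. -/
def normalize (a b : ℕ) (u : ℕ → 𝕜) (n : ℕ) : 𝕜 := jacobiNorm a b n • u n

/-- The canonical unit simplex. -/
def triangle : Set (ℝ × ℝ) := {p | 0 ≤ p.1 ∧ 0 ≤ p.2 ∧ p.2 ≤ 1 - p.1}

/-- Lebesgue measure on the canonical unit simplex. -/
def triangleMeasure : Measure (ℝ × ℝ) := volume.restrict triangle

/-- The Jacobi polynomials on the triangle with parameters `(0,0,0)`, of total degree `n`,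
for `k ≤ n`. -/
def triangleP (n k : ℕ) (p : ℝ × ℝ) : ℝ :=
  (1 - p.1) ^ k * jacobiP (2 * k + 1) 0 (n - k) p.1 * jacobiP 0 0 k (p.2 / (1 - p.1))

theorem continuous_jacobiP (a b n : ℕ) : Continuous (jacobiP a b n) := by
  unfold jacobiP
  fun_prop

theorem measurableSet_triangle : MeasurableSet triangle := by
  apply MeasurableSet.inter
  · exact measurableSet_le measurable_const measurable_fst
  · apply MeasurableSet.inter
    · exact measurableSet_le measurable_const measurable_snd
    · exact measurableSet_le measurable_snd (measurable_const.sub measurable_fst)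

theorem triangle_subset : triangle ⊆ Icc (0 : ℝ) 1 ×ˢ Icc (0 : ℝ) 1 := by
  rintro ⟨x, y⟩ ⟨hx, hy, hxy⟩
  simp only at hx hy hxy
  refine ⟨⟨hx, ?_⟩, ⟨hy, ?_⟩⟩ <;> simp only <;> linarith

instance : IsFiniteMeasure triangleMeasure := by
  refine ⟨?_⟩
  rw [triangleMeasure, Measure.restrict_apply_univ]
  exact lt_of_le_of_lt (measure_mono triangle_subset)
    (isCompact_Icc.prod isCompact_Icc).measure_lt_top

theorem measurable_triangleP (n k : ℕ) : Measurable (triangleP n k) := by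
  unfold triangleP
  refine Measurable.mul (Measurable.mul ?_ ?_) ?_
  · fun_prop
  · exact (continuous_jacobiP _ _ _).measurable.comp measurable_fst
  · exact (continuous_jacobiP _ _ _).measurable.comp
      (measurable_snd.div (measurable_const.sub measurable_fst))

theorem exists_bound_triangleP (n k : ℕ) : ∃ C : ℝ, ∀ p ∈ triangle, |triangleP n k p| ≤ C := by
  obtain ⟨C₁, h₁⟩ := (isCompact_Icc (a := (0 : ℝ)) (b := 1)).exists_bound_of_continuousOn
    (continuous_jacobiP (2 * k + 1) 0 (n - k)).continuousOn
  obtain ⟨C₂, h₂⟩ := (isCompact_Icc (a := (0 : ℝ)) (b := 1)).exists_bound_of_continuousOn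
    (continuous_jacobiP 0 0 k).continuousOn
  refine ⟨1 * C₁ * C₂, ?_⟩
  rintro ⟨x, y⟩ ⟨hx, hy, hxy⟩
  simp only at hx hy hxy
  have hx1 : x ≤ 1 := by linarith
  have e₁ := h₁ x ⟨hx, hx1⟩
  have e₂ := h₂ (y / (1 - x)) ⟨div_nonneg hy (by linarith), div_le_one_of_le₀ hxy (by linarith)⟩
  rw [Real.norm_eq_abs] at e₁ e₂
  have e₀ : |(1 - x) ^ k| ≤ 1 := by
    rw [abs_of_nonneg (pow_nonneg (by linarith) k)]
    exact pow_le_one₀ (by linarith) (by linarith)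
  simp only [triangleP, abs_mul]
  have hC₁ : 0 ≤ C₁ := (abs_nonneg _).trans e₁
  gcongr

theorem memLp_triangleP (n k : ℕ) :
    MemLp (fun p => ((triangleP n k p : ℝ) : 𝕜)) 2 triangleMeasure := by
  obtain ⟨C, hC⟩ := exists_bound_triangleP n k
  refine MemLp.of_bound
    (RCLike.measurable_ofReal.comp (measurable_triangleP n k)).aestronglyMeasurable C ?_
  rw [triangleMeasure]
  filter_upwards [ae_restrict_mem measurableSet_triangle] with p hp
  rw [RCLike.norm_ofReal]
  exact hC p hp

/-- The function on the triangle with coefficients `f n k`, as the `L²` sum of the series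
`∑_n ∑_{k ≤ n} f_{n,k} P_{n,k}`. -/
def triangleSynthesis (f : ℕ → ℕ → 𝕜) : Lp 𝕜 2 triangleMeasure :=
  ∑' n : ℕ, ∑ k ∈ Finset.range (n + 1), f n k • (memLp_triangleP (𝕜 := 𝕜) n k).toLp

/-- The `(n,k)`-th coefficient (`k ≤ n`) of a function on the triangle. -/
def triangleCoeff (g : ℝ × ℝ → 𝕜) (n k : ℕ) : 𝕜 :=
  ((∫ p, triangleP n k p ^ 2 ∂triangleMeasure)⁻¹ : ℝ) •
    ∫ p, triangleP n k p • g p ∂triangleMeasure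

/-! The operators on coefficient sequences (with respect to unnormalized polynomials). -/

/-- `E_y`: extension of a function of one variable, `u ↦ ((x,y) ↦ u(y))`, from the
`(1,0)` Jacobi basis to the triangle basis. -/
def extendY (u : ℕ → 𝕜) (n k : ℕ) : 𝕜 :=
  ((-1) ^ (n + k) * (2 * k + 1) / (n + 1) : ℝ) • u n

/-- `K(1 - J_x, J_y)`: multiplication by `K(1 - x, y)` on the triangle. -/
def kernelMul (K : ℝ → ℝ → 𝕜) (f : ℕ → ℕ → 𝕜) : ℕ → ℕ → 𝕜 :=
  triangleCoeff (fun p => K (1 - p.1) p.2 * triangleSynthesis f p)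

/-- `Q_y`: integration over `0 ≤ y ≤ 1 - x` up to the weight `1 - x`, from the triangle basis to
the `(1,0)` Jacobi basis. -/
def integrateY (f : ℕ → ℕ → 𝕜) (n : ℕ) : 𝕜 := f n 0

/-- `L_{(1,0)}^{(0,0)}`: multiplication by `1 - x`, from the `(1,0)` basis to the `(0,0)` basis;
`(1 - x) P_n^{(1,0)} = (P_n^{(0,0)} - P_{n+1}^{(0,0)}) / 2`. -/
def lowering (u : ℕ → 𝕜) : ℕ → 𝕜
  | 0 => (1 / 2 : ℝ) • u 0
  | n + 1 => (1 / 2 : ℝ) • (u (n + 1) - u n)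

/-- `R`: the reflection `f ↦ f(1 - ·)` in the `(0,0)` basis. -/
def reflect (u : ℕ → 𝕜) (n : ℕ) : 𝕜 := ((-1) ^ n : ℝ) • u n

/-- `S_{(0,0)}^{(1,0)}`: conversion from the `(0,0)` basis to the `(1,0)` basis;
`P_n^{(0,0)} = ((n+1) P_n^{(1,0)} - n P_{n-1}^{(1,0)}) / (2n+1)`. -/
def raising (u : ℕ → 𝕜) (n : ℕ) : 𝕜 :=
  ((n + 1) / (2 * n + 1) : ℝ) • u n - ((n + 1) / (2 * n + 3) : ℝ) • u (n + 1)

/-- The product `L_{(1,0)}^{(0,0)} Q_y K(1 - J_x, J_y) E_y`, from the `(1,0)` basis to the `(0,0)`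
basis. -/
def volterraLQKE (K : ℝ → ℝ → 𝕜) (u : ℕ → 𝕜) : ℕ → 𝕜 :=
  lowering (integrateY (kernelMul K (extendY u)))

end VolterraJacobi

end

noncomputable section

namespace VolterraJacobi

variable {𝕜 : Type*} [RCLike 𝕜]

/-! The analytic half is the Hilbert–Schmidt criterion. Against `(1-y) dy` the Volterra operator has
kernel `K(x,y)/(1-y)` on `y < x`; with output weight `1-x` its squared Hilbert–Schmidt norm is the
integral of `(1-x)/(1-y) |K|²`, and the quotient is at most `1` there. So every `L²` kernel gives a
compact operator on the weighted space (`memLp_reflected_triangleKernel`,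
`isCompactOperator_kernelOperator`). Without reflection and return to the `(1,0)` basis, the output
weight `1-x` is lost: either the input lies in `L²(dy)`, where the plain kernel is square
integrable, or `|K|²/(1-y)` must be integrable.

The algebraic half identifies the matrix product with that operator. The second marginal of the
triangle measure is `(1-y) dy`, so `u ↦ u(y)` is an isometry into `L²` of the triangle, and the
finite identity `sum_triangleP` says that `E_y` describes it on each basis polynomial. Hence
synthesis after `E_y` returns `u(y)` (`triangleSynthesis_extendY`). After multiplication by
`K(1-x,y)`, only the coefficients against `P_{n,0} = P_n^{(1,0)}(x)` are read off, and Fubini turns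
them into integrals of `∫_0^{1-x} K(1-x,y) u(y) dy`. The maps `L`, `R`, `S` are then checked on
coefficients, by duality: `L` through the expansion of `P^{(0,0)}` in `P^{(1,0)}`, `S` through that
of `(1-x) P^{(1,0)}` in `P^{(0,0)}`.

That the coefficient maps are isometric isomorphisms rests on orthogonality, norms and completeness
of the `(0,0)` and `(1,0)` families, all derived from explicit binomial expansions. -/

/-! ### Binomial expansions of Jacobi polynomials -/

/-- The subtraction is real, and for `n < k` both sides vanish. Together with the next lemma this
reduces neighbouring binomials to a common one, so that coefficient identities become rational
identities. -/
theorem choose_succ_mul_succ (n k : ℕ) :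
    (n.choose (k + 1) : ℝ) * (k + 1) = n.choose k * (n - k) := by
  rcases le_or_gt k n with h | h
  · have := Nat.choose_succ_right_eq n k
    rw [← Nat.cast_sub h]
    exact_mod_cast this
  · simp [Nat.choose_eq_zero_of_lt h, Nat.choose_eq_zero_of_lt (Nat.lt_succ_of_lt h)]

theorem succ_choose_succ_mul_succ (n k : ℕ) :
    ((n + 1).choose (k + 1) : ℝ) * (k + 1) = n.choose k * (n + 1) := by
  have := Nat.add_one_mul_choose_eq n k
  have h : ((n + 1 : ℕ) : ℝ) * n.choose k = (n + 1).choose (k + 1) * ((k + 1 : ℕ) : ℝ) := by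
    exact_mod_cast this
  push_cast at h
  linarith

/-- Reversing the sum exchanges the roles of `x` and `x - 1`, up to sign, and those of `a` and `b`.
-/
theorem jacobiP_one_sub (a b n : ℕ) (x : ℝ) :
    jacobiP a b n (1 - x) = (-1) ^ n * jacobiP b a n x := by
  unfold jacobiP
  rw [← Finset.sum_range_reflect, Finset.mul_sum]
  refine Finset.sum_congr rfl fun s hs => ?_
  have hs' : s ≤ n := Nat.lt_succ_iff.1 (Finset.mem_range.1 hs)
  obtain ⟨r, rfl⟩ := Nat.exists_eq_add_of_le hs'
  have e1 : s + r + 1 - 1 - s = r := by omega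
  have e2 : s + r - r = s := by omega
  have e3 : s + r - s = r := by omega
  rw [e1, e2, e3, show (1 - x - 1) = -1 * x by ring, show (1 - x) = -1 * (x - 1) by ring,
    mul_pow, mul_pow, pow_add]
  ring

/-- The expansion of a Jacobi polynomial in powers of `1 - x`. -/
theorem jacobiP_one_sub_eq_sum (a b n : ℕ) (t : ℝ) :
    jacobiP a b n (1 - t) = ∑ j ∈ Finset.range (n + 1),
      (-1) ^ j * ((n + a).choose (n - j) : ℝ) * ((n + a + b + j).choose j : ℝ) * t ^ j := by
  have h1 : jacobiP a b n (1 - t) = ∑ s ∈ Finset.range (n + 1), ∑ i ∈ Finset.range (n + 1 - s),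
      ((n + a).choose (n - s) : ℝ) * ((n + b).choose s : ℝ) * ((n - s).choose i : ℝ) *
        (-t) ^ (s + i) := by
    unfold jacobiP
    refine Finset.sum_congr rfl fun s hs => ?_
    have hs' : s ≤ n := Nat.lt_succ_iff.1 (Finset.mem_range.1 hs)
    rw [show 1 - t - 1 = -t by ring, show 1 - t = -t + 1 by ring, add_pow,
      show n - s + 1 = n + 1 - s by omega, Finset.mul_sum]
    refine Finset.sum_congr rfl fun i _ => ?_
    rw [pow_add, one_pow]
    ring
  -- Collect by the total power `j = s + i` of `t`; the inner sum over `s` is then a Vandermonde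
  -- convolution.
  rw [h1, ← Finset.sum_range_diag_flip (n + 1) (fun s i =>
    ((n + a).choose (n - s) : ℝ) * ((n + b).choose s : ℝ) * ((n - s).choose i : ℝ) *
        (-t) ^ (s + i))]
  refine Finset.sum_congr rfl fun j hj => ?_
  have hj' : j ≤ n := Nat.lt_succ_iff.1 (Finset.mem_range.1 hj)
  have h2 : (n + a + b + j).choose j =
      ∑ s ∈ Finset.range (j + 1), (n + b).choose s * (a + j).choose (j - s) := by
    rw [show n + a + b + j = (n + b) + (a + j) by ring, Nat.add_choose_eq,
      Finset.Nat.sum_antidiagonal_eq_sum_range_succ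
        (fun p q => (n + b).choose p * (a + j).choose q)]
  rw [h2, Nat.cast_sum, Finset.mul_sum, Finset.sum_mul]
  refine Finset.sum_congr rfl fun s hs => ?_
  have hs' : s ≤ j := Nat.lt_succ_iff.1 (Finset.mem_range.1 hs)
  have h3 : (n + a).choose (n - s) * (n - s).choose (j - s) =
      (n + a).choose (n - j) * (a + j).choose (j - s) := by
    rw [← Nat.choose_symm (show j - s ≤ n - s by omega), show n - s - (j - s) = n - j by omega,
      Nat.choose_mul (by omega), show n + a - (n - j) = a + j by omega,
      show n - s - (n - j) = j - s by omega]
  have h3' : ((n + a).choose (n - s) : ℝ) * (n - s).choose (j - s) =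
      (n + a).choose (n - j) * (a + j).choose (j - s) := by exact_mod_cast h3
  rw [show s + (j - s) = j by omega, neg_pow, Nat.cast_mul]
  linear_combination ((n + b).choose s : ℝ) * ((-1) ^ j * t ^ j) * h3'

/-- Both sides are `(n+a+j)! / ((n-j)! (a+j)! j!)`. The right-hand form vanishes by itself for `j >
n`. -/
theorem choose_mul_choose_add (a n j : ℕ) (hj : j ≤ n) :
    (n + a).choose (n - j) * (n + a + j).choose j =
      (n + a + j).choose (2 * j + a) * (2 * j + a).choose j := by
  rw [Nat.choose_mul (by omega), show n + a + j - j = n + a by omega,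
    show 2 * j + a - j = n + a - (n - j) by omega, Nat.choose_symm (by omega), mul_comm]

/-- The free length `M` lets polynomials of different degrees be compared term by term. -/
theorem jacobiP_zero_right_one_sub (a n M : ℕ) (hM : n < M) (t : ℝ) :
    jacobiP a 0 n (1 - t) = ∑ j ∈ Finset.range M,
      (-1) ^ j * (((n + a + j).choose (2 * j + a) : ℝ) * ((2 * j + a).choose j : ℝ)) * t ^ j := by
  rw [jacobiP_one_sub_eq_sum]
  have : ∀ j ∈ Finset.range (n + 1), (-1) ^ j * ((n + a).choose (n - j) : ℝ) *
      ((n + a + 0 + j).choose j : ℝ) * t ^ j =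
      (-1) ^ j * (((n + a + j).choose (2 * j + a) : ℝ) * ((2 * j + a).choose j : ℝ)) * t ^ j := by
    intro j hj
    have := choose_mul_choose_add a n j (Nat.lt_succ_iff.1 (Finset.mem_range.1 hj))
    have h : ((n + a).choose (n - j) : ℝ) * (n + a + j).choose j =
      (n + a + j).choose (2 * j + a) * (2 * j + a).choose j := by exact_mod_cast this
    rw [add_zero, ← h]
    ring
  rw [Finset.sum_congr rfl this]
  refine Finset.sum_subset (Finset.range_subset_range.2 hM) fun j _ hj => ?_
  have hj' : n < j := by simpa using hj
  rw [Nat.choose_eq_zero_of_lt (show n + a + j < 2 * j + a by omega)]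
  simp

theorem jacobiP_zero_right (a n M : ℕ) (hM : n < M) (x : ℝ) :
    jacobiP a 0 n x = ∑ j ∈ Finset.range M, (-1) ^ j *
      (((n + a + j).choose (2 * j + a) : ℝ) * ((2 * j + a).choose j : ℝ)) * (1 - x) ^ j := by
  rw [← jacobiP_zero_right_one_sub a n M hM, sub_sub_cancel]

theorem succ_mul_choose_two_mul_succ (j : ℕ) :
    ((2 * j + 1).choose j : ℝ) * (j + 1) = (2 * j).choose j * (2 * j + 1) := by
  have h := succ_choose_succ_mul_succ (2 * j) j
  have h2 : (2 * j + 1).choose (j + 1) = (2 * j + 1).choose j := by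
    rw [← Nat.choose_symm (show j + 1 ≤ 2 * j + 1 by omega)]
    congr 1
    omega
  rw [h2] at h
  push_cast at h
  exact h

theorem choose_two_mul_add_two (j : ℕ) :
    ((2 * (j + 1)).choose (j + 1) : ℝ) = 2 * (2 * j + 1).choose j := by
  rw [show 2 * (j + 1) = 2 * j + 1 + 1 by ring, Nat.choose_succ_succ]
  have h2 : (2 * j + 1).choose (j + 1) = (2 * j + 1).choose j := by
    rw [← Nat.choose_symm (show j + 1 ≤ 2 * j + 1 by omega)]
    congr 1
    omega
  rw [Nat.succ_eq_add_one, h2]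
  push_cast
  ring

/-- `(1 - x) P_n^{(1,0)} = (P_n^{(0,0)} - P_{n+1}^{(0,0)}) / 2`. -/
theorem one_sub_mul_jacobiP_one (n : ℕ) (x : ℝ) :
    (1 - x) * jacobiP 1 0 n x = (jacobiP 0 0 n x - jacobiP 0 0 (n + 1) x) / 2 := by
  rw [jacobiP_zero_right 1 n (n + 1) (by omega), jacobiP_zero_right 0 n (n + 2) (by omega),
    jacobiP_zero_right 0 (n + 1) (n + 2) (by omega), ← Finset.sum_sub_distrib,
    Finset.sum_range_succ' _ (n + 1)]
  simp only [add_zero, mul_zero, Nat.choose_zero_right, pow_zero, sub_self, Finset.mul_sum,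
    Finset.sum_div]
  refine Finset.sum_congr rfl fun j _ => ?_
  have h : ((n + 1 + (j + 1)).choose (2 * (j + 1)) : ℝ) =
      (n + 1 + j).choose (2 * j + 1) + (n + (j + 1)).choose (2 * (j + 1)) := by
    rw [show n + 1 + (j + 1) = (n + 1 + j) + 1 by ring, show 2 * (j + 1) = 2 * j + 1 + 1 by ring,
      Nat.choose_succ_succ, show n + (j + 1) = n + 1 + j by ring]
    push_cast
    rfl
  rw [h, choose_two_mul_add_two]
  ring

/-- `(2n+3) P_{n+1}^{(0,0)} = (n+2) P_{n+1}^{(1,0)} - (n+1) P_n^{(1,0)}`. -/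
theorem jacobiP_zero_succ (n : ℕ) (x : ℝ) :
    (2 * n + 3) * jacobiP 0 0 (n + 1) x =
      (n + 2) * jacobiP 1 0 (n + 1) x - (n + 1) * jacobiP 1 0 n x := by
  rw [jacobiP_zero_right 0 (n + 1) (n + 2) (by omega), jacobiP_zero_right 1 n (n + 2) (by omega),
    jacobiP_zero_right 1 (n + 1) (n + 2) (by omega), Finset.mul_sum, Finset.mul_sum,
    Finset.mul_sum, ← Finset.sum_sub_distrib]
  refine Finset.sum_congr rfl fun j _ => ?_
  -- All binomials are expressed through `(n+1+j).choose (2j)` and `(2j).choose j`.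
  have h1 := succ_choose_succ_mul_succ (n + 1 + j) (2 * j)
  have h2 := choose_succ_mul_succ (n + 1 + j) (2 * j)
  have h3 := succ_mul_choose_two_mul_succ j
  rw [show n + 1 + 1 + j = n + 1 + j + 1 by ring, add_zero, add_zero]
  push_cast at h1 h2
  have hj : (2 * j + 1 : ℝ) ≠ 0 := by positivity
  have hj' : (j + 1 : ℝ) ≠ 0 := by positivity
  have e1 := (eq_div_iff hj).2 h1
  have e2 := (eq_div_iff hj).2 h2
  have e3 := (eq_div_iff hj').2 h3
  rw [e1, e2, e3]
  field_simp
  ring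

theorem jacobiP_zero (a b : ℕ) (x : ℝ) : jacobiP a b 0 x = 1 := by
  simp [jacobiP]

theorem jacobiP_zero_left_one (n : ℕ) : jacobiP 0 0 n 1 = 1 := by
  rw [jacobiP_zero_right 0 n (n + 1) (by omega), Finset.sum_range_succ']
  simp

/-! ### Derivatives of Legendre polynomials -/

theorem legendre_zero (n : ℕ) : jacobiP 0 0 n 0 = (-1) ^ n := by
  have := jacobiP_one_sub 0 0 n 1
  rw [sub_self, jacobiP_zero_left_one] at this
  simpa using this

theorem hasDerivAt_legendre_sum (n M : ℕ) (hM : n ≤ M) (x : ℝ) :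
    HasDerivAt (jacobiP 0 0 n) (∑ j ∈ Finset.range M, (-1) ^ j *
      (((n + (j + 1)).choose (2 * (j + 1)) : ℝ) * ((2 * (j + 1)).choose (j + 1) : ℝ)) *
        ((j + 1) * (1 - x) ^ j)) x := by
  have h : jacobiP 0 0 n = fun x => ∑ j ∈ Finset.range M, (-1) ^ (j + 1) *
      (((n + (j + 1)).choose (2 * (j + 1)) : ℝ) * ((2 * (j + 1)).choose (j + 1) : ℝ)) *
        (1 - x) ^ (j + 1) + 1 := by
    funext x
    rw [jacobiP_zero_right 0 n (M + 1) (by omega), Finset.sum_range_succ']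
    simp
  rw [h]
  refine HasDerivAt.add_const 1 (HasDerivAt.fun_sum fun j _ => ?_)
  have h1 : HasDerivAt (fun x : ℝ => (1 - x) ^ (j + 1)) (-((j + 1) * (1 - x) ^ j)) x := by
    simpa using ((hasDerivAt_id x).const_sub 1).fun_pow (j + 1)
  refine (h1.const_mul ((-1) ^ (j + 1) * (((n + (j + 1)).choose (2 * (j + 1)) : ℝ) *
    ((2 * (j + 1)).choose (j + 1) : ℝ)))).congr_deriv ?_
  rw [pow_succ]
  ring

theorem hasDerivAt_legendre (n : ℕ) (x : ℝ) :
    HasDerivAt (jacobiP 0 0 n) (deriv (jacobiP 0 0 n) x) x :=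
  (hasDerivAt_legendre_sum n n le_rfl x).differentiableAt.hasDerivAt

/-- The classical recurrence for `P'_{n+2} - P'_n`, with an extra factor `2` from the argument `2x -
1`. It exhibits `P_{n+1}` as the derivative of a function vanishing at both endpoints. -/
theorem deriv_legendre_add_two (n : ℕ) (x : ℝ) : deriv (jacobiP 0 0 (n + 2)) x =
    deriv (jacobiP 0 0 n) x + 2 * (2 * n + 3) * jacobiP 0 0 (n + 1) x := by
  rw [(hasDerivAt_legendre_sum n (n + 2) (by omega) x).deriv,
    (hasDerivAt_legendre_sum (n + 2) (n + 2) (by omega) x).deriv,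
    jacobiP_zero_right 0 (n + 1) (n + 2) (by omega), Finset.mul_sum, ← Finset.sum_add_distrib]
  refine Finset.sum_congr rfl fun j _ => ?_
  have h1 := succ_choose_succ_mul_succ (n + 1 + j) (2 * j)
  have h2 := choose_succ_mul_succ (n + 1 + j) (2 * j)
  have h3 := succ_mul_choose_two_mul_succ j
  have h4 : ((n + 2 + (j + 1)).choose (2 * (j + 1)) : ℝ) =
      (n + 1 + j + 1).choose (2 * j + 1) + (n + 1 + j).choose (2 * j + 1) +
        (n + (j + 1)).choose (2 * (j + 1)) := by
    rw [show n + 2 + (j + 1) = (n + 1 + j) + 1 + 1 by ring,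
      show 2 * (j + 1) = 2 * j + 1 + 1 by ring, Nat.choose_succ_succ (n + 1 + j + 1),
      show n + (j + 1) = n + 1 + j by ring, Nat.succ_eq_add_one,
      Nat.choose_succ_succ (n + 1 + j) (2 * j + 1)]
    push_cast
    ring
  rw [h4, choose_two_mul_add_two, add_zero, add_zero]
  push_cast at h1 h2
  have hj : (2 * j + 1 : ℝ) ≠ 0 := by positivity
  have hj' : (j + 1 : ℝ) ≠ 0 := by positivity
  have e1 := (eq_div_iff hj).2 h1
  have e2 := (eq_div_iff hj).2 h2
  have e3 := (eq_div_iff hj').2 h3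
  rw [e1, e2, e3]
  field_simp
  ring

/-! ### Expansion of `P_n^{(1,0)}(y)` on the triangle -/

/-- A telescoping sum, which vanishes for `m < L`. -/
theorem sum_range_choose_mul_choose (m i L : ℕ) :
    ∑ k ∈ Finset.range L, (-1 : ℝ) ^ k * ((2 * k + 1) * (m - i)) *
      ((2 * m + 1).choose (m + k + 1) * (k + i).choose (2 * i)) =
    (-1) ^ (L + 1) * ((2 * m + 1) * (2 * i + 1)) *
      ((2 * m).choose (m + L) * (L + i).choose (2 * i + 1)) := by
  induction L with
  | zero =>
    have : i.choose (2 * i + 1) = 0 := Nat.choose_eq_zero_of_lt (by omega)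
    simp [this]
  | succ k ih =>
    rw [Finset.sum_range_succ, ih]
    have h1 := succ_choose_succ_mul_succ (2 * m) (m + k)
    have h2 := choose_succ_mul_succ (2 * m) (m + k)
    have h3 := succ_choose_succ_mul_succ (k + i) (2 * i)
    have h4 := choose_succ_mul_succ (k + i) (2 * i)
    rw [show k + 1 + i = k + i + 1 by ring, ← add_assoc]
    push_cast at h1 h2 h3 h4
    have hi : (2 * i + 1 : ℝ) ≠ 0 := by positivity
    have hmk : (m + k + 1 : ℝ) ≠ 0 := by positivity
    have e1 := (eq_div_iff hmk).2 h1
    have e2 := (eq_div_iff hmk).2 h2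
    have e3 := (eq_div_iff hi).2 h3
    have e4 := (eq_div_iff hi).2 h4
    rw [e1, e2, e3, e4, pow_succ (-1 : ℝ) (k + 1), pow_succ]
    field_simp
    ring

/-- The expansion of a monomial in Legendre polynomials. -/
theorem sum_choose_mul_legendre (m : ℕ) (z : ℝ) :
    ∑ k ∈ Finset.range (m + 1), (2 * k + 1) * ((2 * m + 1).choose (m + k + 1) : ℝ) *
      jacobiP 0 0 k z = (2 * m + 1) * (2 * m).choose m * z ^ m := by
  have h1 : ∀ k ∈ Finset.range (m + 1),
      (2 * k + 1) * ((2 * m + 1).choose (m + k + 1) : ℝ) * jacobiP 0 0 k z =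
      ∑ i ∈ Finset.range (m + 1), (2 * k + 1) * ((2 * m + 1).choose (m + k + 1) : ℝ) *
        ((-1) ^ (k + i) * ((k + i).choose (2 * i) * (2 * i).choose i) * z ^ i) := by
    intro k hk
    have : jacobiP 0 0 k z = (-1) ^ k * jacobiP 0 0 k (1 - z) := by
      rw [← jacobiP_one_sub, sub_sub_cancel]
    rw [this, jacobiP_zero_right_one_sub 0 k (m + 1) (Finset.mem_range.1 hk), Finset.mul_sum,
      Finset.mul_sum]
    refine Finset.sum_congr rfl fun i _ => ?_
    rw [pow_add, add_zero, add_zero]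
    ring
  rw [Finset.sum_congr rfl h1, Finset.sum_comm, Finset.sum_range_succ, Finset.sum_eq_zero,
    zero_add]
  · rw [Finset.sum_range_succ, Finset.sum_eq_zero]
    · rw [← two_mul, Nat.choose_self, Nat.choose_self, pow_mul]
      simp
      ring
    · intro k hk
      have hk' := Finset.mem_range.1 hk
      rw [Nat.choose_eq_zero_of_lt (show k + m < 2 * m by omega)]
      simp
  · intro i hi
    have hi' := Finset.mem_range.1 hi
    have hne : (m - i : ℝ) ≠ 0 := by
      rw [sub_ne_zero]
      exact_mod_cast hi'.ne'
    -- At `L = m + 1` the closed form contains `(2m).choose (2m+1) = 0`, so the coefficient of `z^i`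
    -- vanishes once the nonzero factor `m - i` is cancelled.
    have h2 := sum_range_choose_mul_choose m i (m + 1)
    rw [Nat.choose_eq_zero_of_lt (show 2 * m < m + (m + 1) by omega), Nat.cast_zero, zero_mul,
      mul_zero] at h2
    rw [← mul_right_inj' hne, mul_zero, ← mul_zero ((-1) ^ i * (2 * i).choose i * z ^ i), ← h2, Finset.mul_sum, Finset.mul_sum]
    refine Finset.sum_congr rfl fun k _ => ?_
    rw [pow_add]
    ring

/-- The factor `(2m+1) (2m).choose m` is kept next to `y^m` because `sum_choose_mul_legendre`
replaces exactly this product by Legendre polynomials. -/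
theorem jacobiP_one_eq_sum (n : ℕ) (y : ℝ) :
    (n + 1) * jacobiP 1 0 n y = ∑ m ∈ Finset.range (n + 1), (-1) ^ (n + m) *
      (n + 1 + m).choose (2 * m + 1) * ((2 * m + 1) * (2 * m).choose m * y ^ m) := by
  have : jacobiP 1 0 n y = (-1) ^ n * jacobiP 0 1 n (1 - y) := by
    rw [← jacobiP_one_sub, sub_sub_cancel]
  rw [this, jacobiP_one_sub_eq_sum, Finset.mul_sum, Finset.mul_sum]
  refine Finset.sum_congr rfl fun m hm => ?_
  have hm' := Nat.lt_succ_iff.1 (Finset.mem_range.1 hm)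
  have h1 := choose_mul_choose_add 1 n m hm'
  have h1' : ((n + 1).choose (m + 1) : ℝ) * (n + 1 + m).choose m =
      (n + 1 + m).choose (2 * m + 1) * (2 * m + 1).choose m := by
    rw [← Nat.choose_symm (show m + 1 ≤ n + 1 by omega), show n + 1 - (m + 1) = n - m by omega]
    exact_mod_cast h1
  have h2 := succ_choose_succ_mul_succ n m
  have h3 := succ_mul_choose_two_mul_succ m
  rw [add_zero, Nat.choose_symm hm', pow_add]
  linear_combination (-1 : ℝ) ^ n * (-1) ^ m * y ^ m *
    (-(n + 1 + m).choose m * h2 + (m + 1) * h1' + (n + 1 + m).choose (2 * m + 1) * h3)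

/-- The expansion of `(x,y) ↦ P_n^{(1,0)}(y)` in Jacobi polynomials on the triangle. -/
theorem sum_triangleP (n : ℕ) (p : ℝ × ℝ) (hp : p.1 ≠ 1) :
    ∑ k ∈ Finset.range (n + 1), ((-1) ^ (n + k) * (2 * k + 1) / (n + 1) : ℝ) * triangleP n k p =
      jacobiP 1 0 n p.2 := by
  obtain ⟨x, y⟩ := p
  simp only [triangleP]
  have hx : 1 - x ≠ 0 := by
    simp only at hp
    rwa [sub_ne_zero, ne_comm]
  have hn : (n + 1 : ℝ) ≠ 0 := by positivity
  -- In the coordinates `t = 1 - x`, `y = t z` both sides become double sums of `t^m P_k(z)`, which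
  -- are compared with `m = k + j`.
  obtain ⟨t, ht⟩ : ∃ t, 1 - x = t := ⟨_, rfl⟩
  obtain ⟨z, rfl⟩ : ∃ z, y = t * z := ⟨y / t, by rw [mul_div_cancel₀ _ (ht ▸ hx)]⟩
  obtain rfl : x = 1 - t := by linarith
  rw [ht, mul_div_cancel_left₀ _ (ht ▸ hx), ← mul_right_inj' hn, jacobiP_one_eq_sum,
    Finset.mul_sum]
  have h1 : ∀ m ∈ Finset.range (n + 1), (-1) ^ (n + m) *
      ((n + 1 + m).choose (2 * m + 1) : ℝ) * ((2 * m + 1) * (2 * m).choose m * (t * z) ^ m) =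
      ∑ k ∈ Finset.range (m + 1), (-1) ^ (n + m) * (n + 1 + m).choose (2 * m + 1) * t ^ m *
        ((2 * k + 1) * ((2 * m + 1).choose (m + k + 1) : ℝ) * jacobiP 0 0 k z) := by
    intro m _
    rw [← Finset.mul_sum, sum_choose_mul_legendre, mul_pow]
    ring
  rw [Finset.sum_congr rfl h1]
  have h2 : ∀ k ∈ Finset.range (n + 1), (n + 1 : ℝ) * ((-1) ^ (n + k) * (2 * k + 1) / (n + 1) *
      (t ^ k * jacobiP (2 * k + 1) 0 (n - k) (1 - t) * jacobiP 0 0 k z)) =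
      ∑ j ∈ Finset.range (n + 1 - k), (-1) ^ (n + (k + j)) *
        (n + 1 + (k + j)).choose (2 * (k + j) + 1) * t ^ (k + j) *
        ((2 * k + 1) * ((2 * (k + j) + 1).choose ((k + j) + k + 1) : ℝ) * jacobiP 0 0 k z) := by
    intro k hk
    have hk' := Nat.lt_succ_iff.1 (Finset.mem_range.1 hk)
    rw [jacobiP_zero_right_one_sub (2 * k + 1) (n - k) (n + 1 - k) (by omega), Finset.mul_sum,
      Finset.sum_mul, Finset.mul_sum, Finset.mul_sum]
    refine Finset.sum_congr rfl fun j _ => ?_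
    rw [show n - k + (2 * k + 1) + j = n + 1 + (k + j) by omega,
      show 2 * j + (2 * k + 1) = 2 * (k + j) + 1 by ring,
      ← Nat.choose_symm (show j ≤ 2 * (k + j) + 1 by omega),
      show 2 * (k + j) + 1 - j = k + j + k + 1 by omega]
    field_simp
    ring
  rw [Finset.sum_congr rfl h2, ← Finset.sum_range_diag_flip (n + 1) (fun k j =>
    (-1 : ℝ) ^ (n + (k + j)) * (n + 1 + (k + j)).choose (2 * (k + j) + 1) * t ^ (k + j) *
        ((2 * k + 1) * ((2 * (k + j) + 1).choose ((k + j) + k + 1) : ℝ) * jacobiP 0 0 k z))]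
  refine Finset.sum_congr rfl fun m _ => Finset.sum_congr rfl fun k hk => ?_
  have hk' := Nat.lt_succ_iff.1 (Finset.mem_range.1 hk)
  rw [show k + (m - k) = m by omega]

/-! ### Orthogonality and norms -/

theorem continuous_deriv_legendre (n : ℕ) : Continuous (deriv (jacobiP 0 0 n)) := by
  have : deriv (jacobiP 0 0 n) = _ :=
    funext fun x => (hasDerivAt_legendre_sum n n le_rfl x).deriv
  rw [this]
  fun_prop

theorem deriv_legendre_zero (x : ℝ) : deriv (jacobiP 0 0 0) x = 0 := by
  rw [(hasDerivAt_legendre_sum 0 0 le_rfl x).deriv, Finset.sum_range_zero]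

theorem deriv_legendre_one (x : ℝ) : deriv (jacobiP 0 0 1) x = 2 * jacobiP 0 0 0 x := by
  rw [(hasDerivAt_legendre_sum 1 1 le_rfl x).deriv, jacobiP_zero, Finset.sum_range_one]
  norm_num [Nat.choose]

/-- Integration by parts with `P_{n+2} - P_n` as antiderivative; the boundary terms vanish since
`P_n` and `P_{n+2}` agree at `0` and at `1`. -/
theorem integral_legendre_succ_mul (n m : ℕ) :
    2 * (2 * n + 3) * ∫ x in (0 : ℝ)..1, jacobiP 0 0 (n + 1) x * jacobiP 0 0 m x =
      (∫ x in (0 : ℝ)..1, jacobiP 0 0 n x * deriv (jacobiP 0 0 m) x) -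
        ∫ x in (0 : ℝ)..1, jacobiP 0 0 (n + 2) x * deriv (jacobiP 0 0 m) x := by
  have hc := fun n => continuous_jacobiP 0 0 n
  have hd := continuous_deriv_legendre m
  have h := intervalIntegral.integral_mul_deriv_eq_deriv_mul (a := (0 : ℝ)) (b := 1)
    (u := jacobiP 0 0 m) (u' := deriv (jacobiP 0 0 m))
    (v := fun x => jacobiP 0 0 (n + 2) x - jacobiP 0 0 n x)
    (v' := fun x => 2 * (2 * n + 3) * jacobiP 0 0 (n + 1) x)
    (fun x _ => hasDerivAt_legendre m x)
    (fun x _ => ((hasDerivAt_legendre (n + 2) x).sub (hasDerivAt_legendre n x)).congr_deriv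
      (by rw [deriv_legendre_add_two]; ring))
    (hd.intervalIntegrable _ _) ((continuous_const.mul (hc _)).intervalIntegrable _ _)
  simp only [jacobiP_zero_left_one, legendre_zero, pow_add, sub_self, mul_zero, even_two,
    Even.neg_pow, one_pow, mul_one, zero_sub] at h
  have hi : ∀ k, IntervalIntegrable (fun x => jacobiP 0 0 k x * deriv (jacobiP 0 0 m) x)
      volume 0 1 := fun k => ((hc k).mul hd).intervalIntegrable _ _
  rw [← intervalIntegral.integral_const_mul, ← intervalIntegral.integral_sub (hi _) (hi _)]
  calc _ = ∫ x in (0 : ℝ)..1, jacobiP 0 0 m x * (2 * (2 * n + 3) * jacobiP 0 0 (n + 1) x) :=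
        intervalIntegral.integral_congr fun x _ => by ring
    _ = _ := by
        rw [h, ← intervalIntegral.integral_neg]
        exact intervalIntegral.integral_congr fun x _ => by ring

theorem integral_legendre_mul_deriv_add_two (n m : ℕ) :
    (∫ x in (0 : ℝ)..1, jacobiP 0 0 n x * deriv (jacobiP 0 0 (m + 2)) x) =
      (∫ x in (0 : ℝ)..1, jacobiP 0 0 n x * deriv (jacobiP 0 0 m) x) +
        2 * (2 * m + 3) * ∫ x in (0 : ℝ)..1, jacobiP 0 0 n x * jacobiP 0 0 (m + 1) x := by
  have hc := fun n => continuous_jacobiP 0 0 n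
  have hd := continuous_deriv_legendre m
  have h1 : IntervalIntegrable (fun x => jacobiP 0 0 n x * deriv (jacobiP 0 0 m) x)
      volume 0 1 := ((hc n).mul hd).intervalIntegrable _ _
  have h2 : IntervalIntegrable
      (fun x => 2 * (2 * (m : ℝ) + 3) * (jacobiP 0 0 n x * jacobiP 0 0 (m + 1) x)) volume 0 1 :=
    (continuous_const.mul ((hc _).mul (hc _))).intervalIntegrable _ _
  rw [← intervalIntegral.integral_const_mul, ← intervalIntegral.integral_add h1 h2]
  refine intervalIntegral.integral_congr fun x _ => ?_
  rw [deriv_legendre_add_two]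
  ring

theorem integral_legendre_mul_deriv_one (n : ℕ) :
    (∫ x in (0 : ℝ)..1, jacobiP 0 0 n x * deriv (jacobiP 0 0 1) x) =
      2 * ∫ x in (0 : ℝ)..1, jacobiP 0 0 n x * jacobiP 0 0 0 x := by
  rw [← intervalIntegral.integral_const_mul]
  refine intervalIntegral.integral_congr fun x _ => ?_
  rw [deriv_legendre_one]
  ring

/-- The recurrence lowers `m` by two at the cost of `∫ P_n P_{m+1}`, and integration by parts turns
that integral back into integrals against `P'_{m+1}`. Quantifying over all `n` lets a two-step
induction on `m` close this loop. -/
theorem integral_legendre_mul_deriv_of_le (m : ℕ) : ∀ n, m ≤ n →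
    ∫ x in (0 : ℝ)..1, jacobiP 0 0 n x * deriv (jacobiP 0 0 m) x = 0 := by
  induction m using Nat.twoStepInduction with
  | zero =>
    intro n _
    simp [deriv_legendre_zero]
  | one =>
    intro n hn
    obtain ⟨n, rfl⟩ := Nat.exists_eq_add_of_le' hn
    have h := integral_legendre_succ_mul n 0
    simp only [deriv_legendre_zero, mul_zero, intervalIntegral.integral_zero, sub_zero] at h
    rw [integral_legendre_mul_deriv_one]
    rcases mul_eq_zero.1 h with h | h
    · exact absurd h (by positivity)
    · rw [h, mul_zero]
  | more m ih1 ih2 =>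
    intro n hn
    obtain ⟨n, rfl⟩ := Nat.exists_eq_add_of_le' (show 1 ≤ n by omega)
    have h := integral_legendre_succ_mul n (m + 1)
    rw [ih2 n (by omega), ih2 (n + 2) (by omega), sub_zero] at h
    rw [integral_legendre_mul_deriv_add_two, ih1 _ (by omega)]
    rcases mul_eq_zero.1 h with h | h
    · exact absurd h (by positivity)
    · rw [h, mul_zero, add_zero]

theorem integral_legendre_mul_of_lt {n m : ℕ} (h : m < n) :
    ∫ x in (0 : ℝ)..1, jacobiP 0 0 n x * jacobiP 0 0 m x = 0 := by
  obtain ⟨n, rfl⟩ := Nat.exists_eq_add_of_le' (show 1 ≤ n by omega)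
  have h := integral_legendre_succ_mul n m
  rw [integral_legendre_mul_deriv_of_le m n (by omega),
    integral_legendre_mul_deriv_of_le m (n + 2) (by omega), sub_zero] at h
  exact (mul_eq_zero.1 h).resolve_left (by positivity)

theorem integral_legendre_mul_self (n : ℕ) :
    ∫ x in (0 : ℝ)..1, jacobiP 0 0 n x * jacobiP 0 0 n x = 1 / (2 * n + 1) := by
  induction n with
  | zero => simp [jacobiP_zero]
  | succ n ih =>
    have h := integral_legendre_succ_mul n (n + 1)
    rw [integral_legendre_mul_deriv_of_le (n + 1) (n + 2) (by omega), sub_zero] at h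
    -- The derivative recurrence gives `2 (2n+1) ‖P_n‖²`, which is `2` by induction.
    have h2 : ∫ x in (0 : ℝ)..1, jacobiP 0 0 n x * deriv (jacobiP 0 0 (n + 1)) x = 2 := by
      cases n with
      | zero => rw [integral_legendre_mul_deriv_one, ih]; norm_num
      | succ n =>
        rw [integral_legendre_mul_deriv_add_two,
          integral_legendre_mul_deriv_of_le n (n + 1) (by omega), ih]
        push_cast
        field_simp
        ring
    rw [h2] at h
    rw [eq_div_iff (by positivity)]
    push_cast
    linarith

theorem integral_legendre_mul (n m : ℕ) :
    ∫ x in (0 : ℝ)..1, jacobiP 0 0 n x * jacobiP 0 0 m x =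
      if n = m then 1 / (2 * n + 1 : ℝ) else 0 := by
  split_ifs with h
  · rw [← h, integral_legendre_mul_self]
  · rcases lt_or_gt_of_ne h with h | h
    · simp_rw [mul_comm (jacobiP 0 0 n _)]
      exact integral_legendre_mul_of_lt h
    · exact integral_legendre_mul_of_lt h

/-- The telescoped form of `jacobiP_zero_succ`: the Christoffel–Darboux kernel at the endpoint `1`.
-/
theorem succ_mul_jacobiP_one (n : ℕ) (x : ℝ) : (n + 1) * jacobiP 1 0 n x =
    ∑ k ∈ Finset.range (n + 1), (2 * k + 1) * jacobiP 0 0 k x := by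
  induction n with
  | zero => simp [jacobiP_zero]
  | succ n ih =>
    rw [Finset.sum_range_succ, ← ih]
    have := jacobiP_zero_succ n x
    push_cast
    linarith

/-- One factor is the Christoffel–Darboux sum, the other absorbs the weight as `(P_m - P_{m+1})/2`.
Legendre orthogonality leaves half the difference of the indicators of `m ≤ n` and `m + 1 ≤ n`. -/
theorem integral_jacobiP_one_mul (n m : ℕ) :
    ∫ x in (0 : ℝ)..1, (1 - x) * (jacobiP 1 0 n x * jacobiP 1 0 m x) =
      if n = m then 1 / (2 * n + 2 : ℝ) else 0 := by
  have hc := fun n => continuous_jacobiP 0 0 n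
  have hn : (n + 1 : ℝ) ≠ 0 := by positivity
  rw [← mul_right_inj' hn, ← intervalIntegral.integral_const_mul]
  have h1 : ∀ x : ℝ, (n + 1) * ((1 - x) * (jacobiP 1 0 n x * jacobiP 1 0 m x)) =
      ∑ k ∈ Finset.range (n + 1), ((2 * k + 1) / 2 * (jacobiP 0 0 k x * jacobiP 0 0 m x) -
        (2 * k + 1) / 2 * (jacobiP 0 0 k x * jacobiP 0 0 (m + 1) x)) := by
    intro x
    calc _ = (n + 1) * jacobiP 1 0 n x * ((1 - x) * jacobiP 1 0 m x) := by ring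
      _ = _ := by
        rw [one_sub_mul_jacobiP_one, succ_mul_jacobiP_one, Finset.sum_mul]
        exact Finset.sum_congr rfl fun k _ => by ring
  have hi : ∀ k m : ℕ, IntervalIntegrable
      (fun x => (2 * k + 1 : ℝ) / 2 * (jacobiP 0 0 k x * jacobiP 0 0 m x)) volume 0 1 :=
    fun k m => (continuous_const.mul ((hc _).mul (hc _))).intervalIntegrable _ _
  simp_rw [h1]
  rw [intervalIntegral.integral_finsetSum fun k _ => (hi k _).sub (hi k _)]
  simp_rw [fun k => intervalIntegral.integral_sub (hi k m) (hi k (m + 1)),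
    intervalIntegral.integral_const_mul, integral_legendre_mul, mul_ite, mul_zero]
  have h2 : ∀ k : ℕ, (2 * k + 1 : ℝ) / 2 * (1 / (2 * k + 1)) = 1 / 2 := by
    intro k
    field_simp
  simp_rw [h2]
  rw [Finset.sum_sub_distrib, Finset.sum_ite_eq', Finset.sum_ite_eq']
  simp only [Finset.mem_range]
  split_ifs <;> first | omega | skip
  · norm_num
  · rw [sub_zero, show (2 * n + 2 : ℝ) = 2 * (n + 1) by ring]
    field_simp
  · norm_num

theorem jacobiWeight_nonneg (a b : ℕ) {x : ℝ} (hx : x ∈ Ioo (0 : ℝ) 1) :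
    0 ≤ jacobiWeight a b x :=
  mul_nonneg (pow_nonneg (by linarith [hx.2]) _) (pow_nonneg hx.1.le _)

theorem continuous_jacobiWeight (a b : ℕ) : Continuous (jacobiWeight a b) := by
  unfold jacobiWeight
  fun_prop

theorem jacobiWeight_zero (x : ℝ) : jacobiWeight 0 0 x = 1 := by
  simp [jacobiWeight]

theorem jacobiWeight_one (x : ℝ) : jacobiWeight 1 0 x = 1 - x := by
  simp [jacobiWeight]

theorem jacobiNorm_sq (a b n : ℕ) : jacobiNorm a b n ^ 2 =
    ∫ x in Ioo (0 : ℝ) 1, jacobiWeight a b x * jacobiP a b n x ^ 2 :=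
  Real.sq_sqrt (setIntegral_nonneg measurableSet_Ioo fun _ hx =>
    mul_nonneg (jacobiWeight_nonneg a b hx) (sq_nonneg _))

theorem jacobiNorm_zero_sq (n : ℕ) : jacobiNorm 0 0 n ^ 2 = 1 / (2 * n + 1) := by
  rw [jacobiNorm_sq, ← integral_Ioc_eq_integral_Ioo,
    ← intervalIntegral.integral_of_le zero_le_one, ← integral_legendre_mul_self]
  simp [jacobiWeight_zero, sq]

theorem jacobiNorm_one_sq (n : ℕ) : jacobiNorm 1 0 n ^ 2 = 1 / (2 * n + 2) := by
  have h := integral_jacobiP_one_mul n n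
  rw [if_pos rfl] at h
  rw [jacobiNorm_sq, ← integral_Ioc_eq_integral_Ioo,
    ← intervalIntegral.integral_of_le zero_le_one, ← h]
  simp [jacobiWeight_one, sq]

theorem jacobiP_zero_orthogonal (n m : ℕ) (h : n ≠ m) :
    ∫ x in Ioo (0 : ℝ) 1, jacobiWeight 0 0 x * (jacobiP 0 0 n x * jacobiP 0 0 m x) = 0 := by
  have := integral_legendre_mul n m
  rw [if_neg h] at this
  rw [← integral_Ioc_eq_integral_Ioo, ← intervalIntegral.integral_of_le zero_le_one]
  simpa [jacobiWeight_zero] using this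

theorem jacobiP_one_orthogonal (n m : ℕ) (h : n ≠ m) :
    ∫ x in Ioo (0 : ℝ) 1, jacobiWeight 1 0 x * (jacobiP 1 0 n x * jacobiP 1 0 m x) = 0 := by
  have := integral_jacobiP_one_mul n m
  rw [if_neg h] at this
  rw [← integral_Ioc_eq_integral_Ioo, ← intervalIntegral.integral_of_le zero_le_one]
  simpa [jacobiWeight_one] using this

theorem jacobiNorm_zero_ne (n : ℕ) : jacobiNorm 0 0 n ≠ 0 := by
  intro h0
  have h := jacobiNorm_zero_sq n
  have : (0 : ℝ) < 1 / (2 * n + 1) := by positivity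
  rw [← h, h0] at this
  norm_num at this

theorem jacobiNorm_one_ne (n : ℕ) : jacobiNorm 1 0 n ≠ 0 := by
  intro h0
  have h := jacobiNorm_one_sq n
  have : (0 : ℝ) < 1 / (2 * n + 2) := by positivity
  rw [← h, h0] at this
  norm_num at this

/-! ### Completeness: the Jacobi Hilbert bases -/

theorem monomial_mem_span_jacobiP_zero (m : ℕ) :
    (fun x : ℝ => x ^ m) ∈ Submodule.span ℝ (range (jacobiP 0 0)) := by
  have h : (fun x : ℝ => x ^ m) = ∑ k ∈ Finset.range (m + 1),
      (((2 * m + 1) * (2 * m).choose m : ℝ)⁻¹ *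
        ((2 * k + 1) * ((2 * m + 1).choose (m + k + 1) : ℝ))) • jacobiP 0 0 k := by
    funext x
    have hc : (0 : ℝ) < (2 * m).choose m := by exact_mod_cast Nat.choose_pos (by omega)
    rw [Finset.sum_apply]
    simp only [Pi.smul_apply, smul_eq_mul]
    simp_rw [mul_assoc ((2 * m + 1) * (2 * m).choose m : ℝ)⁻¹]
    rw [← Finset.mul_sum, sum_choose_mul_legendre]
    field_simp
  rw [h]
  exact Submodule.sum_mem _ fun k _ =>
    Submodule.smul_mem _ _ (Submodule.subset_span (mem_range_self k))

theorem monomial_mem_span_jacobiP_one (m : ℕ) :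
    (fun x : ℝ => x ^ m) ∈ Submodule.span ℝ (range (jacobiP 1 0)) := by
  refine Submodule.span_le.2 ?_ (monomial_mem_span_jacobiP_zero m)
  rintro _ ⟨n, rfl⟩
  have hq : ∀ n, jacobiP 1 0 n ∈ Submodule.span ℝ (range (jacobiP 1 0)) := fun n =>
    Submodule.subset_span (mem_range_self n)
  cases n with
  | zero =>
    have : jacobiP 0 0 0 = jacobiP 1 0 0 := funext fun x => by rw [jacobiP_zero, jacobiP_zero]
    exact this ▸ hq 0
  | succ n =>
    have : jacobiP 0 0 (n + 1) = ((n + 2) / (2 * n + 3) : ℝ) • jacobiP 1 0 (n + 1) -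
        ((n + 1) / (2 * n + 3) : ℝ) • jacobiP 1 0 n := by
      funext x
      have h := jacobiP_zero_succ n x
      simp only [Pi.sub_apply, Pi.smul_apply, smul_eq_mul]
      field_simp
      linarith
    rw [this]
    exact Submodule.sub_mem _ (Submodule.smul_mem _ _ (hq _)) (Submodule.smul_mem _ _ (hq _))

instance isFiniteMeasure_jacobiMeasure (a b : ℕ) : IsFiniteMeasure (jacobiMeasure a b) := by
  refine isFiniteMeasure_withDensity_ofReal ?_
  exact ((continuous_jacobiWeight a b).integrableOn_Icc.mono_set Ioo_subset_Icc_self).2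

theorem ae_jacobiMeasure_mem (a b : ℕ) : ∀ᵐ x ∂(jacobiMeasure a b), x ∈ Ioo (0 : ℝ) 1 :=
  (withDensity_absolutelyContinuous _ _).ae_le (ae_restrict_mem measurableSet_Ioo)

theorem integral_jacobiMeasure (a b : ℕ) (f : ℝ → 𝕜) :
    ∫ x, f x ∂(jacobiMeasure a b) = ∫ x in Ioo (0 : ℝ) 1, jacobiWeight a b x • f x := by
  rw [jacobiMeasure, integral_withDensity_eq_integral_toReal_smul
    (continuous_jacobiWeight a b).measurable.ennreal_ofReal (by simp)]
  refine setIntegral_congr_fun measurableSet_Ioo fun x hx => ?_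
  rw [ENNReal.toReal_ofReal (jacobiWeight_nonneg a b hx)]

theorem memLp_jacobiMeasure_of_continuous (a b : ℕ) {f : ℝ → 𝕜} (hf : Continuous f) :
    MemLp f 2 (jacobiMeasure a b) := by
  obtain ⟨C, hC⟩ := (isCompact_Icc (a := (0 : ℝ)) (b := 1)).exists_bound_of_continuousOn
    hf.continuousOn
  refine MemLp.of_bound hf.aestronglyMeasurable C ?_
  filter_upwards [ae_jacobiMeasure_mem a b] with x hx
  exact hC x (Ioo_subset_Icc_self hx)

theorem continuous_ofReal_comp {f : ℝ → ℝ} (hf : Continuous f) :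
    Continuous fun x => (f x : 𝕜) :=
  RCLike.continuous_ofReal.comp hf

variable (𝕜) in
/-- The element of `L²` defined by a continuous real function. -/
def ofRealLp (a b : ℕ) (f : ℝ → ℝ) (hf : Continuous f) : Lp 𝕜 2 (jacobiMeasure a b) :=
  (memLp_jacobiMeasure_of_continuous a b (continuous_ofReal_comp (𝕜 := 𝕜) hf)).toLp

variable (𝕜) in
/-- The normalized shifted Jacobi polynomial as an element of `L²`. -/
def jacobiLp (a b n : ℕ) : Lp 𝕜 2 (jacobiMeasure a b) :=
  ofRealLp 𝕜 a b (fun x => (jacobiNorm a b n)⁻¹ * jacobiP a b n x)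
    (continuous_const.mul (continuous_jacobiP a b n))

theorem coeFn_ofRealLp (a b : ℕ) (f : ℝ → ℝ) (hf : Continuous f) :
    ofRealLp 𝕜 a b f hf =ᵐ[jacobiMeasure a b] fun x => (f x : 𝕜) :=
  MemLp.coeFn_toLp _

theorem inner_ofRealLp (a b : ℕ) (f : ℝ → ℝ) (hf : Continuous f)
    (u : Lp 𝕜 2 (jacobiMeasure a b)) :
    inner 𝕜 (ofRealLp 𝕜 a b f hf) u = ∫ x in Ioo (0 : ℝ) 1, (jacobiWeight a b x * f x) • u x := by
  rw [L2.inner_def]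
  have h : ∀ᵐ x ∂(jacobiMeasure a b), inner 𝕜 (ofRealLp 𝕜 a b f hf x) (u x) = f x • u x := by
    filter_upwards [coeFn_ofRealLp (𝕜 := 𝕜) a b f hf] with x hx
    rw [hx, RCLike.inner_apply, RCLike.conj_ofReal, RCLike.real_smul_eq_coe_mul, mul_comm]
  rw [integral_congr_ae h, integral_jacobiMeasure]
  simp_rw [smul_smul]

theorem inner_jacobiLp (a b : ℕ) (n : ℕ) (hn : jacobiNorm a b n ≠ 0)
    (u : Lp 𝕜 2 (jacobiMeasure a b)) :
    inner 𝕜 (jacobiLp 𝕜 a b n) u = normalize a b (jacobiCoeff a b u) n := by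
  rw [jacobiLp, inner_ofRealLp, normalize, jacobiCoeff, smul_smul, ← integral_smul]
  refine integral_congr_ae (ae_of_all _ fun x => ?_)
  simp only
  rw [smul_smul]
  congr 1
  field_simp

theorem orthonormal_jacobiLp (a b : ℕ) (hn : ∀ n, jacobiNorm a b n ≠ 0)
    (horth : ∀ n m, n ≠ m → ∫ x in Ioo (0 : ℝ) 1,
      jacobiWeight a b x * (jacobiP a b n x * jacobiP a b m x) = 0) :
    Orthonormal 𝕜 (jacobiLp 𝕜 a b) := by
  classical
  rw [orthonormal_iff_ite]
  intro i j
  have h1 : inner 𝕜 (jacobiLp 𝕜 a b i) (jacobiLp 𝕜 a b j) =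
      ∫ x in Ioo (0 : ℝ) 1, (((jacobiNorm a b i)⁻¹ * (jacobiNorm a b j)⁻¹ *
        (jacobiWeight a b x * (jacobiP a b i x * jacobiP a b j x)) : ℝ) : 𝕜) := by
    have h2 := coeFn_ofRealLp (𝕜 := 𝕜) a b (fun x => (jacobiNorm a b j)⁻¹ * jacobiP a b j x)
      (continuous_const.mul (continuous_jacobiP a b j))
    rw [L2.inner_def]
    have h : ∀ᵐ x ∂(jacobiMeasure a b), inner 𝕜 (jacobiLp 𝕜 a b i x) (jacobiLp 𝕜 a b j x) =
        (((jacobiNorm a b i)⁻¹ * (jacobiNorm a b j)⁻¹ *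
          (jacobiP a b i x * jacobiP a b j x) : ℝ) : 𝕜) := by
      filter_upwards [h2, coeFn_ofRealLp (𝕜 := 𝕜) a b
        (fun x => (jacobiNorm a b i)⁻¹ * jacobiP a b i x)
        (continuous_const.mul (continuous_jacobiP a b i))] with x hx hx'
      rw [jacobiLp, jacobiLp, hx, hx', RCLike.inner_apply, RCLike.conj_ofReal,
        ← RCLike.ofReal_mul]
      congr 1
      ring
    rw [integral_congr_ae h, integral_jacobiMeasure]
    refine integral_congr_ae (ae_of_all _ fun x => ?_)
    simp only
    rw [RCLike.real_smul_eq_coe_mul, ← RCLike.ofReal_mul]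
    congr 1
    ring
  rw [h1, integral_ofReal, integral_const_mul]
  split_ifs with hij
  · subst hij
    have := jacobiNorm_sq a b i
    simp_rw [sq (jacobiP a b i _)] at this
    rw [← this]
    have := hn i
    norm_cast
    field_simp
  · rw [horth i j hij]
    simp

theorem ofRealLp_add (a b : ℕ) {f g : ℝ → ℝ} (hf : Continuous f) (hg : Continuous g) :
    ofRealLp 𝕜 a b (f + g) (hf.add hg) = ofRealLp 𝕜 a b f hf + ofRealLp 𝕜 a b g hg := by
  refine Lp.ext ?_
  filter_upwards [coeFn_ofRealLp (𝕜 := 𝕜) a b f hf, coeFn_ofRealLp (𝕜 := 𝕜) a b g hg,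
    coeFn_ofRealLp (𝕜 := 𝕜) a b (f + g) (hf.add hg),
    Lp.coeFn_add (ofRealLp 𝕜 a b f hf) (ofRealLp 𝕜 a b g hg)] with x h1 h2 h3 h4
  rw [h3, h4, Pi.add_apply, Pi.add_apply, h1, h2, RCLike.ofReal_add]

theorem ofRealLp_smul (a b : ℕ) (c : ℝ) {f : ℝ → ℝ} (hf : Continuous f) :
    ofRealLp 𝕜 a b (c • f) (hf.const_smul c) = (c : 𝕜) • ofRealLp 𝕜 a b f hf := by
  refine Lp.ext ?_
  filter_upwards [coeFn_ofRealLp (𝕜 := 𝕜) a b f hf,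
    coeFn_ofRealLp (𝕜 := 𝕜) a b (c • f) (hf.const_smul c),
    Lp.coeFn_smul (c : 𝕜) (ofRealLp 𝕜 a b f hf)] with x h1 h2 h3
  rw [h2, h3, Pi.smul_apply, Pi.smul_apply, h1, smul_eq_mul, smul_eq_mul, RCLike.ofReal_mul]

theorem ofRealLp_jacobiP (a b n : ℕ) (hn : jacobiNorm a b n ≠ 0) :
    ofRealLp 𝕜 a b (jacobiP a b n) (continuous_jacobiP a b n) =
      (jacobiNorm a b n : 𝕜) • jacobiLp 𝕜 a b n := by
  have h : jacobiP a b n = jacobiNorm a b n • fun x => (jacobiNorm a b n)⁻¹ * jacobiP a b n x :=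
    funext fun x => (mul_inv_cancel_left₀ hn _).symm
  rw [jacobiLp, ← ofRealLp_smul]
  congr 1

/-- Continuity belongs to the conclusion because span induction runs over bare functions, while
`ofRealLp` needs a continuity proof. -/
theorem ofRealLp_mem_span (a b : ℕ) (hn : ∀ n, jacobiNorm a b n ≠ 0) (f : ℝ → ℝ)
    (hf : f ∈ Submodule.span ℝ (range (jacobiP a b))) :
    ∃ hc : Continuous f,
      ofRealLp 𝕜 a b f hc ∈ Submodule.span 𝕜 (range (jacobiLp 𝕜 a b)) := by
  have h0 : ∀ n, ofRealLp 𝕜 a b (jacobiP a b n) (continuous_jacobiP a b n) ∈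
      Submodule.span 𝕜 (range (jacobiLp 𝕜 a b)) := fun n => by
    rw [ofRealLp_jacobiP a b n (hn n)]
    exact Submodule.smul_mem _ _ (Submodule.subset_span (mem_range_self n))
  induction hf using Submodule.span_induction with
  | mem f hf =>
    obtain ⟨n, rfl⟩ := hf
    exact ⟨continuous_jacobiP a b n, h0 n⟩
  | zero =>
    have h : (0 : ℝ → ℝ) = (0 : ℝ) • jacobiP a b 0 := (zero_smul _ _).symm
    rw [h]
    refine ⟨(continuous_jacobiP a b 0).const_smul 0, ?_⟩
    rw [ofRealLp_smul a b 0 (continuous_jacobiP a b 0)]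
    exact Submodule.smul_mem _ _ (h0 0)
  | add f g _ _ hf hg =>
    obtain ⟨hf, hf'⟩ := hf
    obtain ⟨hg, hg'⟩ := hg
    refine ⟨hf.add hg, ?_⟩
    rw [ofRealLp_add a b hf hg]
    exact Submodule.add_mem _ hf' hg'
  | smul c f _ hf =>
    obtain ⟨hf, hf'⟩ := hf
    refine ⟨hf.const_smul c, ?_⟩
    rw [ofRealLp_smul a b c hf]
    exact Submodule.smul_mem _ _ hf'

theorem polynomial_mem_span (a b : ℕ)
    (hspan : ∀ m : ℕ, (fun x : ℝ => x ^ m) ∈ Submodule.span ℝ (range (jacobiP a b)))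
    (p : Polynomial ℝ) : (fun x => p.eval x) ∈ Submodule.span ℝ (range (jacobiP a b)) := by
  have : (fun x => p.eval x) =
      ∑ i ∈ Finset.range (p.natDegree + 1), p.coeff i • fun x : ℝ => x ^ i := by
    funext x
    rw [Polynomial.eval_eq_sum_range, Finset.sum_apply]
    rfl
  rw [this]
  exact Submodule.sum_mem _ fun i _ => Submodule.smul_mem _ _ (hspan i)

theorem ofRealLp_mem_closure (a b : ℕ) (hn : ∀ n, jacobiNorm a b n ≠ 0)
    (hspan : ∀ m : ℕ, (fun x : ℝ => x ^ m) ∈ Submodule.span ℝ (range (jacobiP a b)))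
    (f : ℝ → ℝ) (hf : Continuous f) : ofRealLp 𝕜 a b f hf ∈
      (Submodule.span 𝕜 (range (jacobiLp 𝕜 a b))).topologicalClosure := by
  rw [← SetLike.mem_coe, Submodule.topologicalClosure_coe, Metric.mem_closure_iff]
  intro ε hε
  set M : ℝ := measureUnivNNReal (jacobiMeasure a b) ^ (2 : ℝ≥0∞).toReal⁻¹ with hM
  have hM0 : 0 ≤ M := by positivity
  -- Weierstrass approximation: `M` is the constant comparing the `L²` norm with the sup norm, and
  -- `M + 1` makes the final inequality strict.
  have hδ : 0 < ε / (M + 1) := by positivity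
  obtain ⟨p, hp⟩ := exists_polynomial_near_of_continuousOn 0 1 f hf.continuousOn _ hδ
  obtain ⟨hc, hmem⟩ := ofRealLp_mem_span (𝕜 := 𝕜) a b hn _ (polynomial_mem_span a b hspan p)
  refine ⟨_, hmem, ?_⟩
  rw [dist_eq_norm]
  refine (Lp.norm_le_of_ae_bound hδ.le ?_).trans_lt (b := M * (ε / (M + 1))) ?_
  · filter_upwards [Lp.coeFn_sub (ofRealLp 𝕜 a b f hf) (ofRealLp 𝕜 a b _ hc),
      coeFn_ofRealLp (𝕜 := 𝕜) a b f hf, coeFn_ofRealLp (𝕜 := 𝕜) a b _ hc,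
      ae_jacobiMeasure_mem a b] with x h1 h2 h3 h4
    rw [h1, Pi.sub_apply, h2, h3, ← RCLike.ofReal_sub, RCLike.norm_ofReal, abs_sub_comm]
    exact (hp x (Ioo_subset_Icc_self h4)).le
  · rw [mul_div_assoc', div_lt_iff₀ (by positivity)]
    nlinarith

theorem topologicalClosure_span_jacobiLp (a b : ℕ) (hn : ∀ n, jacobiNorm a b n ≠ 0)
    (hspan : ∀ m : ℕ, (fun x : ℝ => x ^ m) ∈ Submodule.span ℝ (range (jacobiP a b))) :
    ⊤ ≤ (Submodule.span 𝕜 (range (jacobiLp 𝕜 a b))).topologicalClosure := by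
  set S := (Submodule.span 𝕜 (range (jacobiLp 𝕜 a b))).topologicalClosure with hS
  have hclosed : IsClosed (S : Set (Lp 𝕜 2 (jacobiMeasure a b))) :=
    Submodule.isClosed_topologicalClosure _
  have hsub : (Lp.boundedContinuousFunction 𝕜 2 (jacobiMeasure a b) :
      Set (Lp 𝕜 2 (jacobiMeasure a b))) ⊆ S := by
    intro u hu
    obtain ⟨g, hg⟩ := Lp.mem_boundedContinuousFunction_iff.1 hu
    have hre : Continuous fun x => RCLike.re (g x) := RCLike.continuous_re.comp g.continuous
    have him : Continuous fun x => RCLike.im (g x) := RCLike.continuous_im.comp g.continuous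
    have : u = ofRealLp 𝕜 a b _ hre + (RCLike.I : 𝕜) • ofRealLp 𝕜 a b _ him := by
      refine Lp.ext ?_
      have hu : u =ᵐ[jacobiMeasure a b] g := by
        rw [← hg]
        exact ContinuousMap.coeFn_toAEEqFun _ _
      filter_upwards [hu, Lp.coeFn_add (ofRealLp 𝕜 a b _ hre)
          ((RCLike.I : 𝕜) • ofRealLp 𝕜 a b _ him),
        Lp.coeFn_smul (RCLike.I : 𝕜) (ofRealLp 𝕜 a b _ him),
        coeFn_ofRealLp (𝕜 := 𝕜) a b _ hre, coeFn_ofRealLp (𝕜 := 𝕜) a b _ him]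
        with x h1 h2 h3 h4 h5
      rw [h1, h2, Pi.add_apply, h3, Pi.smul_apply, h4, h5, smul_eq_mul, mul_comm,
        RCLike.re_add_im]
    rw [this]
    exact S.add_mem (ofRealLp_mem_closure a b hn hspan _ hre)
      (S.smul_mem _ (ofRealLp_mem_closure a b hn hspan _ him))
  intro u _
  have hd := Lp.boundedContinuousFunction_dense 𝕜 (jacobiMeasure a b) (p := 2) (by simp)
  exact (hclosed.closure_subset_iff.2 hsub) (hd u)

variable (𝕜) in
theorem exists_hilbertBasis_jacobi (a b : ℕ) (hn : ∀ n, jacobiNorm a b n ≠ 0)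
    (horth : ∀ n m, n ≠ m → ∫ x in Ioo (0 : ℝ) 1,
      jacobiWeight a b x * (jacobiP a b n x * jacobiP a b m x) = 0)
    (hspan : ∀ m : ℕ, (fun x : ℝ => x ^ m) ∈ Submodule.span ℝ (range (jacobiP a b))) :
    ∃ e : HilbertBasis ℕ 𝕜 (Lp 𝕜 2 (jacobiMeasure a b)), (∀ n, e n = jacobiLp 𝕜 a b n) ∧
      ∀ u n, e.repr u n = normalize a b (jacobiCoeff a b u) n := by
  let e := HilbertBasis.mk (orthonormal_jacobiLp (𝕜 := 𝕜) a b hn horth)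
    (topologicalClosure_span_jacobiLp a b hn hspan)
  have he : ∀ n, e n = jacobiLp 𝕜 a b n := fun n => by rw [HilbertBasis.coe_mk]
  refine ⟨e, he, fun u n => ?_⟩
  rw [HilbertBasis.repr_apply_apply, he, inner_jacobiLp a b n (hn n)]

/-! ### Hilbert–Schmidt operators -/

/-- Truncating the expansion of `T u` gives finite-rank operators. By Cauchy–Schwarz and Bessel the
error in operator norm is at most the square root of the tail of `∑ ‖T e_n‖²`. -/
theorem isCompactOperator_of_summable {H F : Type*} [NormedAddCommGroup H]
    [InnerProductSpace 𝕜 H] [NormedAddCommGroup F] [NormedSpace 𝕜 F] [CompleteSpace F]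
    (e : HilbertBasis ℕ 𝕜 H) (T : H →L[𝕜] F) (hT : Summable fun n => ‖T (e n)‖ ^ 2) :
    IsCompactOperator T := by
  let A : ℕ → H →L[𝕜] F := fun N =>
    ∑ n ∈ Finset.range N, (innerSL 𝕜 (e n)).smulRight (T (e n))
  have hA : ∀ N, IsCompactOperator (A N) := by
    intro N
    refine Submodule.sum_mem (compactOperator (RingHom.id 𝕜) H F) fun n _ => ?_
    exact (isCompactOperator_of_locallyCompactSpace_dom (innerSL 𝕜 (e n))).clm_comp
      (ContinuousLinearMap.toSpanSingleton 𝕜 (T (e n)))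
  have hr := tendsto_sum_nat_add fun n => ‖T (e n)‖ ^ 2
  have hlim : Filter.Tendsto A Filter.atTop (nhds T) := by
    rw [tendsto_iff_norm_sub_tendsto_zero]
    have hs := (Real.continuous_sqrt.tendsto 0).comp hr
    rw [Real.sqrt_zero] at hs
    refine squeeze_zero (fun _ => norm_nonneg _) (fun N => ?_) hs
    rw [norm_sub_rev]
    refine ContinuousLinearMap.opNorm_le_bound _ (Real.sqrt_nonneg _) fun u => ?_
    have h1 : HasSum (fun n => inner 𝕜 (e n) u • T (e n)) (T u) := by
      have := T.hasSum (e.hasSum_repr u)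
      simpa [HilbertBasis.repr_apply_apply] using this
    have h2 := (hasSum_nat_add_iff' N).2 h1
    have h3 : (T - A N) u = T u - ∑ n ∈ Finset.range N, inner 𝕜 (e n) u • T (e n) := by
      simp [A]
    rw [h3]
    refine le_of_tendsto h2.norm (Filter.Eventually.of_forall fun s => ?_)
    have h4 : ∑ n ∈ s, ‖inner 𝕜 (e (n + N)) u‖ ^ 2 ≤ ‖u‖ ^ 2 :=
      (e.orthonormal.comp (fun n => n + N) (add_left_injective N)).sum_inner_products_le u
    have h5 : ∑ n ∈ s, ‖T (e (n + N))‖ ^ 2 ≤ ∑' n, ‖T (e (n + N))‖ ^ 2 :=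
      ((summable_nat_add_iff N).2 hT).sum_le_tsum s fun _ _ => sq_nonneg _
    calc ‖∑ n ∈ s, inner 𝕜 (e (n + N)) u • T (e (n + N))‖
        ≤ ∑ n ∈ s, ‖inner 𝕜 (e (n + N)) u‖ * ‖T (e (n + N))‖ :=
          (norm_sum_le _ _).trans_eq (Finset.sum_congr rfl fun n _ => norm_smul _ _)
      _ ≤ √((∑ n ∈ s, ‖inner 𝕜 (e (n + N)) u‖ ^ 2) * ∑ n ∈ s, ‖T (e (n + N))‖ ^ 2) :=
          Real.le_sqrt_of_sq_le (Finset.sum_mul_sq_le_sq_mul_sq _ _ _)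
      _ ≤ √(‖u‖ ^ 2 * ∑' n, ‖T (e (n + N))‖ ^ 2) := by gcongr
      _ = _ := by
          rw [Real.sqrt_mul (sq_nonneg _), Real.sqrt_sq (norm_nonneg _), mul_comm]
          rfl
  exact isCompactOperator_of_tendsto hlim (Filter.Eventually.of_forall hA)

section Kernel

variable {α β : Type*} [MeasurableSpace α] [MeasurableSpace β] {μ : Measure β} {ν : Measure α}

theorem eLpNorm_two_sq {E : Type*} [NormedAddCommGroup E] (f : β → E) (μ : Measure β) :
    eLpNorm f 2 μ ^ 2 = ∫⁻ y, ‖f y‖ₑ ^ 2 ∂μ := by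
  rw [eLpNorm_eq_lintegral_rpow_enorm_toReal two_ne_zero ENNReal.ofNat_ne_top, ← ENNReal.rpow_two,
    ← ENNReal.rpow_mul]
  simp

theorem memLp_two_iff {E : Type*} [NormedAddCommGroup E] {f : β → E} :
    MemLp f 2 μ ↔ AEStronglyMeasurable f μ ∧ ∫⁻ y, ‖f y‖ₑ ^ 2 ∂μ < ∞ := by
  rw [MemLp, ← eLpNorm_two_sq, ENNReal.pow_lt_top_iff]
  simp

theorem enorm_integral_mul_le {f g : β → 𝕜} (hf : AEStronglyMeasurable f μ)
    (hg : AEStronglyMeasurable g μ) :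
    ‖∫ y, f y * g y ∂μ‖ₑ ≤ eLpNorm f 2 μ * eLpNorm g 2 μ := by
  refine (enorm_integral_le_lintegral_enorm _).trans ?_
  simp_rw [enorm_mul]
  have := ENNReal.lintegral_mul_le_Lp_mul_Lq μ (p := 2) (q := 2)
    (Real.HolderConjugate.two_two) hf.enorm hg.enorm
  rw [eLpNorm_eq_lintegral_rpow_enorm_toReal two_ne_zero ENNReal.ofNat_ne_top,
    eLpNorm_eq_lintegral_rpow_enorm_toReal two_ne_zero ENNReal.ofNat_ne_top]
  simpa using this

/-- Bessel's inequality for the conjugate of `f`, since the pairing here is bilinear. -/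
theorem tsum_enorm_integral_mul_sq_le {v : ℕ → Lp 𝕜 2 μ} (hv : Orthonormal 𝕜 v) {f : β → 𝕜}
    (hf : MemLp f 2 μ) : ∑' n, ‖∫ y, f y * v n y ∂μ‖ₑ ^ 2 ≤ ∫⁻ y, ‖f y‖ₑ ^ 2 ∂μ := by
  have hf' : MemLp (fun y => star (f y)) 2 μ := hf.star
  have h1 : ∀ n, ‖∫ y, f y * v n y ∂μ‖ₑ = ‖inner 𝕜 (v n) hf'.toLp‖ₑ := by
    intro n
    rw [← ofReal_norm, ← ofReal_norm, norm_inner_symm, L2.inner_def]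
    congr 2
    refine integral_congr_ae ?_
    filter_upwards [hf'.coeFn_toLp] with y hy
    rw [hy, RCLike.inner_apply, ← RCLike.star_def, star_star, mul_comm]
  have h2 : ∫⁻ y, ‖f y‖ₑ ^ 2 ∂μ = ‖hf'.toLp‖ₑ ^ 2 := by
    rw [Lp.enorm_toLp, eLpNorm_two_sq]
    simp
  rw [h2]
  simp_rw [h1, ← ofReal_norm, ← ENNReal.ofReal_pow (norm_nonneg _)]
  refine ENNReal.summable.tsum_le_of_sum_le fun s => ?_
  rw [← ENNReal.ofReal_sum_of_nonneg fun _ _ => sq_nonneg _]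
  exact ENNReal.ofReal_le_ofReal (hv.sum_inner_products_le _)

variable [SFinite μ] {k : α × β → 𝕜}

theorem ae_memLp_section (hk : MemLp k 2 (ν.prod μ)) :
    ∀ᵐ x ∂ν, MemLp (fun y => k (x, y)) 2 μ := by
  have h := (memLp_two_iff.1 hk).2
  rw [lintegral_prod _ (hk.1.enorm.pow_const 2)] at h
  filter_upwards [ae_lt_top' (hk.1.enorm.pow_const 2).lintegral_prod_right' h.ne,
    hk.1.prodMk_left] with x h1 h2
  exact memLp_two_iff.2 ⟨h2, h1⟩

theorem ae_integrable_kernel_mul (hk : MemLp k 2 (ν.prod μ)) {u : β → 𝕜} (hu : MemLp u 2 μ) :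
    ∀ᵐ x ∂ν, Integrable (fun y => k (x, y) * u y) μ := by
  filter_upwards [ae_memLp_section hk] with x hx
  exact hx.integrable_mul hu

theorem aestronglyMeasurable_kernel_integral (hk : MemLp k 2 (ν.prod μ)) {u : β → 𝕜}
    (hu : MemLp u 2 μ) : AEStronglyMeasurable (fun x => ∫ y, k (x, y) * u y ∂μ) ν :=
  AEStronglyMeasurable.integral_prod_right' (hk.1.mul hu.1.comp_snd)

theorem eLpNorm_kernel_integral_le (hk : MemLp k 2 (ν.prod μ)) {u : β → 𝕜} (hu : MemLp u 2 μ) :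
    eLpNorm (fun x => ∫ y, k (x, y) * u y ∂μ) 2 ν ≤ eLpNorm k 2 (ν.prod μ) * eLpNorm u 2 μ := by
  rw [← ENNReal.pow_le_pow_left_iff two_ne_zero, mul_pow, eLpNorm_two_sq, eLpNorm_two_sq k,
    lintegral_prod _ (hk.1.enorm.pow_const 2),
    ← lintegral_mul_const'' _ (hk.1.enorm.pow_const 2).lintegral_prod_right']
  refine lintegral_mono_ae ?_
  filter_upwards [ae_memLp_section hk] with x hx
  rw [← eLpNorm_two_sq (fun y => k (x, y)), ← mul_pow]
  gcongr
  exact enorm_integral_mul_le hx.1 hu.1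

theorem memLp_kernel_integral (hk : MemLp k 2 (ν.prod μ)) {u : β → 𝕜} (hu : MemLp u 2 μ) :
    MemLp (fun x => ∫ y, k (x, y) * u y ∂μ) 2 ν :=
  ⟨aestronglyMeasurable_kernel_integral hk hu,
    (eLpNorm_kernel_integral_le hk hu).trans_lt (ENNReal.mul_lt_top hk.2 hu.2)⟩

/-- The integral operator with a square integrable kernel. -/
def kernelOperator (hk : MemLp k 2 (ν.prod μ)) : Lp 𝕜 2 μ →L[𝕜] Lp 𝕜 2 ν :=
  LinearMap.mkContinuous
    { toFun := fun u => (memLp_kernel_integral hk (Lp.memLp u)).toLp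
      map_add' := fun u v => by
        rw [← MemLp.toLp_add]
        refine MemLp.toLp_congr _ _ ?_
        filter_upwards [ae_integrable_kernel_mul hk (Lp.memLp u),
          ae_integrable_kernel_mul hk (Lp.memLp v)] with x hu hv
        rw [Pi.add_apply, ← integral_add hu hv]
        refine integral_congr_ae ?_
        filter_upwards [Lp.coeFn_add u v] with y hy
        rw [hy, Pi.add_apply, mul_add]
      map_smul' := fun c u => by
        rw [RingHom.id_apply, ← MemLp.toLp_const_smul]
        refine MemLp.toLp_congr _ _ (ae_of_all _ fun x => ?_)
        rw [Pi.smul_apply, ← integral_smul]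
        refine integral_congr_ae ?_
        filter_upwards [Lp.coeFn_smul c u] with y hy
        rw [hy, Pi.smul_apply, mul_smul_comm] }
    (eLpNorm k 2 (ν.prod μ)).toReal fun u => by
      simp only [LinearMap.coe_mk, AddHom.coe_mk]
      rw [Lp.norm_toLp, Lp.norm_def, ← ENNReal.toReal_mul]
      exact ENNReal.toReal_mono (ENNReal.mul_ne_top hk.2.ne (Lp.eLpNorm_ne_top u))
        (eLpNorm_kernel_integral_le hk (Lp.memLp u))

theorem kernelOperator_ae_eq (hk : MemLp k 2 (ν.prod μ)) (u : Lp 𝕜 2 μ) :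
    kernelOperator hk u =ᵐ[ν] fun x => ∫ y, k (x, y) * u y ∂μ :=
  MemLp.coeFn_toLp (memLp_kernel_integral hk (Lp.memLp u))

theorem enorm_kernelOperator_sq (hk : MemLp k 2 (ν.prod μ)) (u : Lp 𝕜 2 μ) :
    ‖kernelOperator hk u‖ₑ ^ 2 = ∫⁻ x, ‖∫ y, k (x, y) * u y ∂μ‖ₑ ^ 2 ∂ν := by
  rw [Lp.enorm_def, eLpNorm_two_sq]
  refine lintegral_congr_ae ?_
  filter_upwards [kernelOperator_ae_eq hk u] with x hx
  rw [hx]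

/-- By Tonelli the sum of `‖T e_n‖²` may be taken inside the integral over `x`, where Bessel bounds
it by the squared norm of the section `k(x, ·)`. -/
theorem isCompactOperator_kernelOperator (hk : MemLp k 2 (ν.prod μ))
    (e : HilbertBasis ℕ 𝕜 (Lp 𝕜 2 μ)) : IsCompactOperator (kernelOperator hk) := by
  refine isCompactOperator_of_summable e _ ?_
  have h : ∑' n, ‖kernelOperator hk (e n)‖ₑ ^ 2 ≠ ∞ := by
    refine ne_top_of_le_ne_top (memLp_two_iff.1 hk).2.ne ?_
    simp_rw [enorm_kernelOperator_sq]
    rw [← lintegral_tsum fun n =>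
      ((aestronglyMeasurable_kernel_integral hk (Lp.memLp (e n))).enorm.pow_const 2),
      lintegral_prod _ (hk.1.enorm.pow_const 2)]
    refine lintegral_mono_ae ?_
    filter_upwards [ae_memLp_section hk] with x hx
    exact tsum_enorm_integral_mul_sq_le e.orthonormal hx
  simpa using ENNReal.summable_toReal h

end Kernel

/-! ### Marginals of the triangle measure -/

/-- The triangle below the antidiagonal. -/
def lowerTriangle : Set (ℝ × ℝ) := {p | p.2 < 1 - p.1}

theorem measurableSet_lowerTriangle : MeasurableSet lowerTriangle :=
  measurableSet_lt measurable_snd (measurable_const.sub measurable_fst)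

/-- The two sets differ by null lines; the right side is a restricted product measure, to which
Fubini applies. -/
theorem triangleMeasure_eq : triangleMeasure =
    ((volume.restrict (Ioo (0 : ℝ) 1)).prod (volume.restrict (Ioo (0 : ℝ) 1))).restrict
      lowerTriangle := by
  rw [Measure.prod_restrict, Measure.restrict_restrict measurableSet_lowerTriangle,
    triangleMeasure, ← Measure.volume_eq_prod]
  refine Measure.restrict_congr_set ?_
  have h0 : ∀ᵐ x : ℝ, x ≠ 0 := Measure.ae_ne volume 0
  have h1 : ∀ᵐ p : ℝ × ℝ, p.1 ≠ 0 := Measure.quasiMeasurePreserving_fst.ae h0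
  have h2 : ∀ᵐ p : ℝ × ℝ, p.2 ≠ 0 := Measure.quasiMeasurePreserving_snd.ae h0
  have h3 : ∀ᵐ p : ℝ × ℝ, p.2 ≠ 1 - p.1 := by
    rw [Measure.volume_eq_prod, Measure.ae_prod_iff_ae_ae]
    · exact ae_of_all _ fun x => Measure.ae_ne volume (1 - x)
    · exact (measurableSet_eq_fun measurable_snd (measurable_const.sub measurable_fst)).compl
  filter_upwards [h1, h2, h3] with p h1 h2 h3
  refine propext ?_
  change (0 ≤ p.1 ∧ 0 ≤ p.2 ∧ p.2 ≤ 1 - p.1) ↔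
    (p.2 < 1 - p.1 ∧ (0 < p.1 ∧ p.1 < 1) ∧ (0 < p.2 ∧ p.2 < 1))
  constructor
  · rintro ⟨hx, hy, hxy⟩
    have hx' := lt_of_le_of_ne hx h1.symm
    have hy' := lt_of_le_of_ne hy h2.symm
    have hxy' := lt_of_le_of_ne hxy h3
    refine ⟨hxy', ⟨hx', ?_⟩, hy', ?_⟩ <;> linarith
  · rintro ⟨hxy, ⟨hx, -⟩, hy, -⟩
    exact ⟨hx.le, hy.le, hxy.le⟩

theorem Iio_inter_Ioo_zero_one {b : ℝ} (hb : b ≤ 1) : Iio b ∩ Ioo (0 : ℝ) 1 = Ioo 0 b := by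
  rw [inter_comm, Set.Ioo_inter_Iio, min_eq_right hb]

/-- The slice at height `y` has length `1 - y`, the `(1,0)` weight. Hence `u ↦ u ∘ Prod.snd` is an
isometry of `L²` spaces. -/
theorem measurePreserving_snd_triangle :
    MeasurePreserving Prod.snd triangleMeasure (jacobiMeasure 1 0) := by
  refine ⟨measurable_snd, Measure.ext fun B hB => ?_⟩
  have hm := (measurable_snd hB).inter measurableSet_lowerTriangle
  rw [Measure.map_apply measurable_snd hB, triangleMeasure_eq,
    Measure.restrict_apply (measurable_snd hB), Measure.prod_apply_symm hm, jacobiMeasure,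
    withDensity_apply _ hB, ← lintegral_indicator hB]
  refine setLIntegral_congr_fun measurableSet_Ioo fun y hy => ?_
  by_cases hyB : y ∈ B
  · have : (fun x => (x, y)) ⁻¹' (Prod.snd ⁻¹' B ∩ lowerTriangle) = Iio (1 - y) := by
      ext x
      simp only [lowerTriangle, mem_preimage, mem_inter_iff, mem_ofPred_eq, mem_Iio, hyB, true_and]
      constructor <;> intro h <;> linarith
    rw [this, indicator_of_mem hyB, Measure.restrict_apply measurableSet_Iio,
      Iio_inter_Ioo_zero_one (by linarith [hy.1]), Real.volume_Ioo, sub_zero, jacobiWeight_one]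
  · have : (fun x => (x, y)) ⁻¹' (Prod.snd ⁻¹' B ∩ lowerTriangle) = ∅ := by
      ext x
      simp [hyB]
    rw [this, indicator_of_notMem hyB, measure_empty]

theorem measurePreserving_swap_triangle :
    MeasurePreserving Prod.swap triangleMeasure triangleMeasure := by
  have h : Prod.swap ⁻¹' triangle = triangle := by
    ext p
    simp only [triangle, mem_preimage, mem_ofPred_eq, Prod.fst_swap, Prod.snd_swap]
    constructor <;> rintro ⟨h1, h2, h3⟩ <;> refine ⟨h2, h1, ?_⟩ <;> linarith
  have := (Measure.measurePreserving_swap (μ := (volume : Measure ℝ))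
    (ν := (volume : Measure ℝ))).restrict_preimage measurableSet_triangle
  rw [h] at this
  exact this

theorem measurePreserving_fst_triangle :
    MeasurePreserving Prod.fst triangleMeasure (jacobiMeasure 1 0) :=
  measurePreserving_snd_triangle.comp measurePreserving_swap_triangle

theorem measurePreserving_one_sub : MeasurePreserving (fun x : ℝ => 1 - x)
    (volume.restrict (Ioo (0 : ℝ) 1)) (volume.restrict (Ioo (0 : ℝ) 1)) := by
  have := (Measure.measurePreserving_sub_left volume (1 : ℝ)).restrict_preimage
    (measurableSet_Ioo (a := (0 : ℝ)) (b := 1))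
  simpa using this

theorem restrict_Ioo_absolutelyContinuous :
    volume.restrict (Ioo (0 : ℝ) 1) ≪ jacobiMeasure 1 0 := by
  refine withDensity_absolutelyContinuous'
    (continuous_jacobiWeight 1 0).measurable.ennreal_ofReal.aemeasurable ?_
  filter_upwards [ae_restrict_mem measurableSet_Ioo] with x hx
  rw [jacobiWeight_one]
  simpa using hx.2

theorem jacobiCoeff_congr (a b : ℕ) {f g : ℝ → 𝕜}
    (h : f =ᵐ[volume.restrict (Ioo (0 : ℝ) 1)] g) : jacobiCoeff a b f = jacobiCoeff a b g := by
  funext n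
  rw [jacobiCoeff, jacobiCoeff]
  congr 1
  refine integral_congr_ae ?_
  filter_upwards [h] with x hx
  rw [hx]

/-! ### Synthesis of extended functions -/

theorem coeFn_sum_smul_toLp {γ ι : Type*} [MeasurableSpace γ] {m : Measure γ} {f : ι → γ → 𝕜}
    (hf : ∀ i, MemLp (f i) 2 m) (c : ι → 𝕜) (s : Finset ι) :
    (∑ i ∈ s, c i • (hf i).toLp : Lp 𝕜 2 m) =ᵐ[m] fun x => ∑ i ∈ s, c i * f i x := by
  classical
  induction s using Finset.induction_on with
  | empty =>
    filter_upwards [Lp.coeFn_zero 𝕜 2 m] with x hx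
    rw [Finset.sum_empty, hx, Finset.sum_empty, Pi.zero_apply]
  | insert i s hi ih =>
    rw [Finset.sum_insert hi]
    filter_upwards [ih, Lp.coeFn_add (c i • (hf i).toLp) (∑ i ∈ s, c i • (hf i).toLp),
      Lp.coeFn_smul (c i) (hf i).toLp, (hf i).coeFn_toLp] with x h1 h2 h3 h4
    rw [h2, Pi.add_apply, h1, h3, Pi.smul_apply, h4, Finset.sum_insert hi, smul_eq_mul]

theorem sum_extendY_smul_toLp (c : ℕ → 𝕜) (n : ℕ) :
    ∑ k ∈ Finset.range (n + 1), extendY c n k • (memLp_triangleP (𝕜 := 𝕜) n k).toLp =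
      Lp.compMeasurePreservingₗᵢ 𝕜 Prod.snd measurePreserving_snd_triangle
        (c n • ofRealLp 𝕜 1 0 (jacobiP 1 0 n) (continuous_jacobiP 1 0 n)) := by
  rw [map_smul]
  refine Lp.ext ?_
  have h0 : ∀ᵐ x ∂(jacobiMeasure 1 0), x ≠ 1 := by
    filter_upwards [ae_jacobiMeasure_mem 1 0] with x hx
    exact hx.2.ne
  -- `sum_triangleP` excludes `x = 1`, where `y / (1 - x)` is a division by zero; this line is null.
  have h1 : ∀ᵐ p ∂triangleMeasure, p.1 ≠ 1 :=
    measurePreserving_fst_triangle.quasiMeasurePreserving.ae h0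
  have h2 := Lp.coeFn_compMeasurePreserving
    (ofRealLp 𝕜 1 0 (jacobiP 1 0 n) (continuous_jacobiP 1 0 n)) measurePreserving_snd_triangle
  have h3 := measurePreserving_snd_triangle.quasiMeasurePreserving.ae
    (coeFn_ofRealLp (𝕜 := 𝕜) 1 0 (jacobiP 1 0 n) (continuous_jacobiP 1 0 n))
  filter_upwards [h1, h2, h3, coeFn_sum_smul_toLp (fun k => memLp_triangleP (𝕜 := 𝕜) n k)
    (extendY c n) (Finset.range (n + 1)), Lp.coeFn_smul (c n)
      (Lp.compMeasurePreservingₗᵢ 𝕜 Prod.snd measurePreserving_snd_triangle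
        (ofRealLp 𝕜 1 0 (jacobiP 1 0 n) (continuous_jacobiP 1 0 n)))] with p h1 h2 h3 h4 h5
  rw [h4, h5, Pi.smul_apply]
  change _ = c n • (Lp.compMeasurePreserving Prod.snd measurePreserving_snd_triangle
    (ofRealLp 𝕜 1 0 (jacobiP 1 0 n) (continuous_jacobiP 1 0 n))) p
  rw [h2, Function.comp_apply, h3, ← sum_triangleP n p h1, RCLike.ofReal_sum, smul_eq_mul,
    Finset.mul_sum]
  refine Finset.sum_congr rfl fun k _ => ?_
  rw [extendY, RCLike.real_smul_eq_coe_mul, RCLike.ofReal_mul]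
  ring

variable (𝕜) in
theorem exists_hilbertBasis_jacobi_one :
    ∃ e : HilbertBasis ℕ 𝕜 (Lp 𝕜 2 (jacobiMeasure 1 0)), (∀ n, e n = jacobiLp 𝕜 1 0 n) ∧
      ∀ u n, e.repr u n = normalize 1 0 (jacobiCoeff 1 0 u) n :=
  exists_hilbertBasis_jacobi 𝕜 1 0 jacobiNorm_one_ne jacobiP_one_orthogonal
    monomial_mem_span_jacobiP_one

theorem jacobiMeasure_zero : jacobiMeasure 0 0 = volume.restrict (Ioo (0 : ℝ) 1) := by
  simp [jacobiMeasure, jacobiWeight]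

variable (𝕜) in
theorem exists_hilbertBasis_legendre :
    ∃ e : HilbertBasis ℕ 𝕜 (Lp 𝕜 2 (volume.restrict (Ioo (0 : ℝ) 1))),
      ∀ u n, e.repr u n = normalize 0 0 (jacobiCoeff 0 0 u) n := by
  rw [← jacobiMeasure_zero]
  obtain ⟨e, -, he⟩ := exists_hilbertBasis_jacobi 𝕜 0 0 jacobiNorm_zero_ne jacobiP_zero_orthogonal
    monomial_mem_span_jacobiP_zero
  exact ⟨e, he⟩

/-- Grouped by degree, the series is the isometric image of the Hilbert basis expansion of `u`, so
it converges to the image of `u`. -/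
theorem triangleSynthesis_extendY {u : ℝ → 𝕜} (hu : MemLp u 2 (jacobiMeasure 1 0)) :
    triangleSynthesis (extendY (jacobiCoeff 1 0 u)) =ᵐ[triangleMeasure] fun p => u p.2 := by
  obtain ⟨e, he, hrepr⟩ := exists_hilbertBasis_jacobi_one 𝕜
  have hc : jacobiCoeff 1 0 u = jacobiCoeff 1 0 hu.toLp :=
    jacobiCoeff_congr 1 0 (restrict_Ioo_absolutelyContinuous.ae_le hu.coeFn_toLp.symm)
  have hterm : ∀ n, jacobiCoeff 1 0 u n • ofRealLp 𝕜 1 0 (jacobiP 1 0 n)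
      (continuous_jacobiP 1 0 n) = e.repr hu.toLp n • e n := by
    intro n
    rw [ofRealLp_jacobiP 1 0 n (jacobiNorm_one_ne n), hrepr, he, normalize, hc, smul_smul,
      RCLike.real_smul_eq_coe_mul, mul_comm]
  have h : triangleSynthesis (extendY (jacobiCoeff 1 0 u)) =
      Lp.compMeasurePreservingₗᵢ 𝕜 Prod.snd measurePreserving_snd_triangle hu.toLp := by
    rw [triangleSynthesis]
    simp_rw [sum_extendY_smul_toLp, hterm]
    exact ((e.hasSum_repr hu.toLp).mapL (Lp.compMeasurePreservingₗᵢ 𝕜 Prod.snd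
      measurePreserving_snd_triangle).toContinuousLinearMap).tsum_eq
  rw [h]
  exact (Lp.coeFn_compMeasurePreserving hu.toLp measurePreserving_snd_triangle).trans
    (measurePreserving_snd_triangle.quasiMeasurePreserving.ae hu.coeFn_toLp)

/-! ### Coefficient maps as integrals -/

theorem setIntegral_indicator_Iio {b : ℝ} (hb : b ≤ 1) (f : ℝ → 𝕜) :
    ∫ y in Ioo (0 : ℝ) 1, (Iio b).indicator f y = ∫ y in Ioo 0 b, f y := by
  rw [integral_indicator measurableSet_Iio, Measure.restrict_restrict measurableSet_Iio,
    Iio_inter_Ioo_zero_one hb]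

theorem indicator_lowerTriangle (G : ℝ × ℝ → 𝕜) (x : ℝ) :
    (fun y => lowerTriangle.indicator G (x, y)) = (Iio (1 - x)).indicator fun y => G (x, y) := by
  rfl

theorem integral_triangleMeasure {G : ℝ × ℝ → 𝕜} (hG : Integrable G triangleMeasure) :
    ∫ p, G p ∂triangleMeasure =
      ∫ x in Ioo (0 : ℝ) 1, ∫ y in Ioo 0 (1 - x), G (x, y) := by
  rw [triangleMeasure_eq] at hG ⊢
  rw [← IntegrableOn, ← integrable_indicator_iff measurableSet_lowerTriangle] at hG
  rw [← integral_indicator measurableSet_lowerTriangle, integral_prod _ hG]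
  refine setIntegral_congr_fun measurableSet_Ioo fun x hx => ?_
  rw [indicator_lowerTriangle, setIntegral_indicator_Iio (by linarith [hx.1])]

theorem integrableOn_integral_triangle {G : ℝ × ℝ → 𝕜} (hG : Integrable G triangleMeasure) :
    IntegrableOn (fun x => ∫ y in Ioo 0 (1 - x), G (x, y)) (Ioo (0 : ℝ) 1) := by
  rw [triangleMeasure_eq, ← IntegrableOn,
    ← integrable_indicator_iff measurableSet_lowerTriangle] at hG
  refine hG.integral_prod_left.congr ?_
  filter_upwards [ae_restrict_mem measurableSet_Ioo] with x hx
  rw [indicator_lowerTriangle, setIntegral_indicator_Iio (by linarith [hx.1])]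

theorem triangleP_zero (n : ℕ) (p : ℝ × ℝ) : triangleP n 0 p = jacobiP 1 0 n p.1 := by
  simp [triangleP, jacobiP_zero]

theorem integral_triangleP_zero_sq (n : ℕ) :
    ∫ p, triangleP n 0 p ^ 2 ∂triangleMeasure = 1 / (2 * n + 2) := by
  simp_rw [triangleP_zero]
  have hc : Continuous fun x => jacobiP 1 0 n x ^ 2 := (continuous_jacobiP 1 0 n).pow 2
  have h := integral_map (μ := triangleMeasure) measurable_fst.aemeasurable
    (hc.aestronglyMeasurable (μ := Measure.map Prod.fst triangleMeasure))
  rw [← h, measurePreserving_fst_triangle.map_eq, ← jacobiNorm_one_sq, jacobiNorm_sq]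
  exact integral_jacobiMeasure (𝕜 := ℝ) 1 0 _

theorem integrableOn_smul_of_continuous {f : ℝ → ℝ} (hf : Continuous f) {g : ℝ → 𝕜}
    (hg : IntegrableOn g (Ioo (0 : ℝ) 1)) :
    IntegrableOn (fun x => f x • g x) (Ioo (0 : ℝ) 1) := by
  obtain ⟨C, hC⟩ := (isCompact_Icc (a := (0 : ℝ)) (b := 1)).exists_bound_of_continuousOn
    hf.continuousOn
  refine Integrable.bdd_smul hg C hf.aestronglyMeasurable ?_
  filter_upwards [ae_restrict_mem measurableSet_Ioo] with x hx
  exact hC x (Ioo_subset_Icc_self hx)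

theorem smul_integral_sub_smul_integral {f₁ f₂ : ℝ → ℝ} (hf₁ : Continuous f₁)
    (hf₂ : Continuous f₂) {g : ℝ → 𝕜} (hg : IntegrableOn g (Ioo (0 : ℝ) 1)) (c₁ c₂ : ℝ) :
    c₁ • (∫ x in Ioo (0 : ℝ) 1, f₁ x • g x) - c₂ • (∫ x in Ioo (0 : ℝ) 1, f₂ x • g x) =
      ∫ x in Ioo (0 : ℝ) 1, (c₁ * f₁ x - c₂ * f₂ x) • g x := by
  have h₁ := integrableOn_smul_of_continuous (f := fun x => c₁ * f₁ x)
    (continuous_const.mul hf₁) hg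
  have h₂ := integrableOn_smul_of_continuous (f := fun x => c₂ * f₂ x)
    (continuous_const.mul hf₂) hg
  simp_rw [sub_smul]
  rw [← integral_smul, ← integral_smul, integral_sub h₁ h₂]
  simp_rw [mul_smul]

/-- Only integrability of `G` is asked, because the product of `K` and `u` is merely in `L¹`;
boundedness of `P_{n,0}` suffices for Fubini. -/
theorem triangleCoeff_zero {G : ℝ × ℝ → 𝕜} (hG : Integrable G triangleMeasure) (n : ℕ) :
    triangleCoeff G n 0 = (2 * n + 2 : ℝ) •
      ∫ x in Ioo (0 : ℝ) 1, jacobiP 1 0 n x • ∫ y in Ioo 0 (1 - x), G (x, y) := by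
  have hG' : Integrable (fun p => triangleP n 0 p • G p) triangleMeasure := by
    obtain ⟨C, hC⟩ := exists_bound_triangleP n 0
    refine Integrable.bdd_smul hG C (measurable_triangleP n 0).aestronglyMeasurable ?_
    rw [triangleMeasure]
    filter_upwards [ae_restrict_mem measurableSet_triangle] with p hp
    exact hC p hp
  rw [triangleCoeff, integral_triangleP_zero_sq, one_div, inv_inv, integral_triangleMeasure hG']
  simp_rw [triangleP_zero, integral_smul]

theorem jacobiCoeff_zero (f : ℝ → 𝕜) (n : ℕ) : jacobiCoeff 0 0 f n =
    (2 * n + 1 : ℝ) • ∫ x in Ioo (0 : ℝ) 1, jacobiP 0 0 n x • f x := by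
  simp_rw [jacobiCoeff, jacobiNorm_zero_sq, one_div, inv_inv, jacobiWeight_zero, one_mul]

theorem jacobiCoeff_one (f : ℝ → 𝕜) (n : ℕ) : jacobiCoeff 1 0 f n =
    (2 * n + 2 : ℝ) • ∫ x in Ioo (0 : ℝ) 1, ((1 - x) * jacobiP 1 0 n x) • f x := by
  simp_rw [jacobiCoeff, jacobiNorm_one_sq, one_div, inv_inv, jacobiWeight_one]

/-- `L Q_y` takes the triangle coefficients of `G` to the Legendre coefficients of
`x ↦ ∫_0^{1-x} G(x,y) dy`. -/
theorem lowering_integrateY_triangleCoeff {G : ℝ × ℝ → 𝕜} (hG : Integrable G triangleMeasure) :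
    lowering (integrateY (triangleCoeff G)) =
      jacobiCoeff 0 0 fun x => ∫ y in Ioo 0 (1 - x), G (x, y) := by
  have hh := integrableOn_integral_triangle hG
  funext n
  rw [jacobiCoeff_zero]
  cases n with
  | zero =>
    rw [lowering, integrateY, triangleCoeff_zero hG, smul_smul]
    simp_rw [jacobiP_zero]
    norm_num
  | succ n =>
    rw [lowering, integrateY, integrateY, triangleCoeff_zero hG, triangleCoeff_zero hG,
      smul_integral_sub_smul_integral (continuous_jacobiP _ _ _) (continuous_jacobiP _ _ _) hh,
      ← integral_smul, ← integral_smul]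
    refine integral_congr_ae (ae_of_all _ fun x => ?_)
    simp only [smul_smul]
    congr 1
    -- Half the difference of the `(1,0)` coefficients pairs with `(n+2) P_{n+1}^{(1,0)} - (n+1)
    -- P_n^{(1,0)}`, which is `(2n+3) P_{n+1}^{(0,0)}`.
    have := jacobiP_zero_succ n x
    push_cast
    linarith

theorem integrable_kernel_mul {K : ℝ → ℝ → 𝕜}
    (hK : MemLp (fun p : ℝ × ℝ => K (1 - p.1) p.2) 2 triangleMeasure) {u : ℝ → 𝕜}
    (hu : MemLp u 2 (jacobiMeasure 1 0)) :
    Integrable (fun p : ℝ × ℝ => K (1 - p.1) p.2 * u p.2) triangleMeasure :=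
  hK.integrable_mul (hu.comp_measurePreserving measurePreserving_snd_triangle)

theorem volterraLQKE_jacobiCoeff {K : ℝ → ℝ → 𝕜}
    (hK : MemLp (fun p : ℝ × ℝ => K (1 - p.1) p.2) 2 triangleMeasure) {u : ℝ → 𝕜}
    (hu : MemLp u 2 (jacobiMeasure 1 0)) :
    volterraLQKE K (jacobiCoeff 1 0 u) =
      jacobiCoeff 0 0 fun x => ∫ y in Ioo 0 (1 - x), K (1 - x) y * u y := by
  have h : kernelMul K (extendY (jacobiCoeff 1 0 u)) =
      triangleCoeff fun p => K (1 - p.1) p.2 * u p.2 := by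
    funext n k
    rw [kernelMul, triangleCoeff, triangleCoeff]
    congr 1
    refine integral_congr_ae ?_
    filter_upwards [triangleSynthesis_extendY hu] with p hp
    rw [hp]
  rw [volterraLQKE, h, lowering_integrateY_triangleCoeff (integrable_kernel_mul hK hu)]

theorem setIntegral_one_sub (f : ℝ → 𝕜) :
    ∫ x in Ioo (0 : ℝ) 1, f (1 - x) = ∫ x in Ioo (0 : ℝ) 1, f x := by
  rw [← integral_Ioc_eq_integral_Ioo, ← integral_Ioc_eq_integral_Ioo,
    ← intervalIntegral.integral_of_le zero_le_one, ← intervalIntegral.integral_of_le zero_le_one,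
    intervalIntegral.integral_comp_sub_left]
  norm_num

theorem reflect_jacobiCoeff (f : ℝ → 𝕜) :
    reflect (jacobiCoeff 0 0 f) = jacobiCoeff 0 0 fun x => f (1 - x) := by
  funext n
  rw [reflect, jacobiCoeff_zero, jacobiCoeff_zero, smul_comm,
    ← setIntegral_one_sub fun x => jacobiP 0 0 n x • f x, ← integral_smul]
  congr 1
  refine integral_congr_ae (ae_of_all _ fun x => ?_)
  simp only
  rw [jacobiP_one_sub, smul_smul, ← mul_assoc, ← mul_pow]
  norm_num

theorem raising_jacobiCoeff {f : ℝ → 𝕜} (hf : IntegrableOn f (Ioo (0 : ℝ) 1)) :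
    raising (jacobiCoeff 0 0 f) = jacobiCoeff 1 0 f := by
  funext n
  rw [raising, jacobiCoeff_zero, jacobiCoeff_zero, jacobiCoeff_one, smul_smul, smul_smul,
    smul_integral_sub_smul_integral (continuous_jacobiP _ _ _) (continuous_jacobiP _ _ _) hf,
    ← integral_smul]
  refine integral_congr_ae (ae_of_all _ fun x => ?_)
  simp only [smul_smul]
  congr 1
  rw [one_sub_mul_jacobiP_one]
  push_cast
  field_simp
  ring

/-! ### Square integrability of the weighted kernels -/

theorem memLp_two_withDensity {γ : Type*} [MeasurableSpace γ] {m : Measure γ} {w : γ → ℝ}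
    (hw : Measurable w) {f : γ → 𝕜} (hf : AEStronglyMeasurable f m)
    (h : MemLp (fun p => √(w p) • f p) 2 m) :
    MemLp f 2 (m.withDensity fun p => ENNReal.ofReal (w p)) := by
  rw [memLp_two_iff] at h ⊢
  refine ⟨hf.mono_ac (withDensity_absolutelyContinuous _ _), ?_⟩
  rw [lintegral_withDensity_eq_lintegral_mul₀ hw.ennreal_ofReal.aemeasurable
    (hf.enorm.pow_const 2)]
  refine lt_of_eq_of_lt (lintegral_congr fun p => ?_) h.2
  rw [Pi.mul_apply, enorm_smul, mul_pow, Real.enorm_of_nonneg (Real.sqrt_nonneg _),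
    ← ENNReal.ofReal_pow (Real.sqrt_nonneg _)]
  rcases le_total 0 (w p) with hp | hp
  · rw [Real.sq_sqrt hp]
  · rw [Real.sqrt_eq_zero_of_nonpos hp, ENNReal.ofReal_of_nonpos hp]
    simp

theorem memLp_prod_jacobiMeasure {γ : Type*} [MeasurableSpace γ] {m : Measure γ} [SFinite m]
    {f : γ × ℝ → 𝕜} (hf : AEStronglyMeasurable f (m.prod (volume.restrict (Ioo (0 : ℝ) 1))))
    (h : MemLp (fun p => √(1 - p.2) • f p) 2 (m.prod (volume.restrict (Ioo (0 : ℝ) 1)))) :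
    MemLp f 2 (m.prod (jacobiMeasure 1 0)) := by
  rw [jacobiMeasure, prod_withDensity_right
    (continuous_jacobiWeight 1 0).measurable.ennreal_ofReal]
  refine memLp_two_withDensity
    ((continuous_jacobiWeight 1 0).measurable.comp measurable_snd) hf ?_
  simpa only [Function.comp_apply, jacobiWeight_one] using h

theorem memLp_jacobiMeasure_prod {γ : Type*} [MeasurableSpace γ] {m : Measure γ} [SFinite m]
    {f : ℝ × γ → 𝕜} (hf : AEStronglyMeasurable f ((volume.restrict (Ioo (0 : ℝ) 1)).prod m))
    (h : MemLp (fun p => √(1 - p.1) • f p) 2 ((volume.restrict (Ioo (0 : ℝ) 1)).prod m)) :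
    MemLp f 2 ((jacobiMeasure 1 0).prod m) := by
  rw [jacobiMeasure, prod_withDensity_left
    (continuous_jacobiWeight 1 0).measurable.ennreal_ofReal]
  refine memLp_two_withDensity
    ((continuous_jacobiWeight 1 0).measurable.comp measurable_fst) hf ?_
  simpa only [Function.comp_apply, jacobiWeight_one] using h

theorem jacobiMeasure_le : jacobiMeasure 1 0 ≤ volume.restrict (Ioo (0 : ℝ) 1) := by
  conv_rhs => rw [← withDensity_one (μ := volume.restrict (Ioo (0 : ℝ) 1))]
  refine withDensity_mono ?_
  filter_upwards [ae_restrict_mem measurableSet_Ioo] with x hx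
  rw [jacobiWeight_one, Pi.one_apply, ENNReal.ofReal_le_one]
  linarith [hx.1]

/-- The kernel carries `(1-y)⁻¹` to cancel the density of the measure it is integrated against. -/
theorem one_sub_smul_kernel_mul (b : ℝ) (f u : ℝ → 𝕜) {y : ℝ} (hy : y < 1) :
    (1 - y) • ((1 - y)⁻¹ • (Iio b).indicator f y * u y) =
      (Iio b).indicator (fun y => f y * u y) y := by
  rw [smul_mul_assoc, smul_smul, mul_inv_cancel₀ (by linarith), one_smul]
  by_cases h : y ∈ Iio b
  · rw [indicator_of_mem h, indicator_of_mem h]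
  · rw [indicator_of_notMem h, indicator_of_notMem h, zero_mul]

theorem integral_kernel_mul {b : ℝ} (hb : b ≤ 1) (f u : ℝ → 𝕜) :
    ∫ y, (1 - y)⁻¹ • (Iio b).indicator f y * u y ∂(jacobiMeasure 1 0) =
      ∫ y in Ioo 0 b, f y * u y := by
  rw [integral_jacobiMeasure, ← setIntegral_indicator_Iio hb]
  refine setIntegral_congr_fun measurableSet_Ioo fun y hy => ?_
  rw [jacobiWeight_one]
  exact one_sub_smul_kernel_mul b f u hy.2

theorem integrableOn_of_integrable_kernel_mul {b : ℝ} (hb : b ≤ 1) {f u : ℝ → 𝕜}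
    (h : Integrable (fun y => (1 - y)⁻¹ • (Iio b).indicator f y * u y) (jacobiMeasure 1 0)) :
    IntegrableOn (fun y => f y * u y) (Ioo 0 b) := by
  rw [jacobiMeasure, integrable_withDensity_iff_integrable_smul'
    (continuous_jacobiWeight 1 0).measurable.ennreal_ofReal (by simp)] at h
  have h' : Integrable ((Iio b).indicator fun y => f y * u y)
      (volume.restrict (Ioo (0 : ℝ) 1)) := by
    refine h.congr ?_
    filter_upwards [ae_restrict_mem measurableSet_Ioo] with y hy
    rw [ENNReal.toReal_ofReal (jacobiWeight_nonneg 1 0 hy), jacobiWeight_one,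
      one_sub_smul_kernel_mul b f u hy.2]
  rwa [integrable_indicator_iff measurableSet_Iio, IntegrableOn,
    Measure.restrict_restrict measurableSet_Iio, Iio_inter_Ioo_zero_one hb] at h'

/-- The kernel `K(1 - x, y)`, extended by zero from the triangle. -/
def triangleKernel (K : ℝ → ℝ → 𝕜) : ℝ × ℝ → 𝕜 :=
  lowerTriangle.indicator fun p => K (1 - p.1) p.2

theorem triangleKernel_section (K : ℝ → ℝ → 𝕜) (x y : ℝ) :
    triangleKernel K (x, y) = (Iio (1 - x)).indicator (K (1 - x)) y :=
  rfl

theorem memLp_triangleKernel {K : ℝ → ℝ → 𝕜}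
    (hK : MemLp (fun p : ℝ × ℝ => K (1 - p.1) p.2) 2 triangleMeasure) : MemLp (triangleKernel K) 2
    ((volume.restrict (Ioo (0 : ℝ) 1)).prod (volume.restrict (Ioo (0 : ℝ) 1))) := by
  rw [triangleMeasure_eq] at hK
  exact (memLp_indicator_iff_restrict measurableSet_lowerTriangle).2 hK

theorem aestronglyMeasurable_inv_smul {f : ℝ × ℝ → 𝕜} {m : Measure (ℝ × ℝ)}
    (hf : AEStronglyMeasurable f m) :
    AEStronglyMeasurable (fun p => (1 - p.2)⁻¹ • f p) m :=
  (measurable_const.sub measurable_snd).inv.aestronglyMeasurable.smul hf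

/-- The density `1-y` times `|K|²/(1-y)²` is `|K|²/(1-y)`, exactly the extra hypothesis. -/
theorem memLp_weighted_triangleKernel {K : ℝ → ℝ → 𝕜}
    (hK : MemLp (fun p : ℝ × ℝ => K (1 - p.1) p.2) 2 triangleMeasure)
    (hK' : MemLp (fun p : ℝ × ℝ => ((√(1 - p.2))⁻¹ : ℝ) • K (1 - p.1) p.2) 2 triangleMeasure) :
    MemLp (fun p : ℝ × ℝ => (1 - p.2)⁻¹ • triangleKernel K p) 2
      ((volume.restrict (Ioo (0 : ℝ) 1)).prod (jacobiMeasure 1 0)) := by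
  refine memLp_prod_jacobiMeasure (aestronglyMeasurable_inv_smul (memLp_triangleKernel hK).1) ?_
  rw [triangleMeasure_eq, ← memLp_indicator_iff_restrict measurableSet_lowerTriangle] at hK'
  convert hK' using 1
  funext p
  rw [smul_smul, ← div_eq_mul_inv, Real.sqrt_div_self, triangleKernel]
  by_cases h : p ∈ lowerTriangle
  · rw [indicator_of_mem h, indicator_of_mem h]
  · rw [indicator_of_notMem h, indicator_of_notMem h, smul_zero]

theorem memLp_reflected_triangleKernel {K : ℝ → ℝ → 𝕜}
    (hK : MemLp (fun p : ℝ × ℝ => K (1 - p.1) p.2) 2 triangleMeasure) :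
    MemLp (fun p : ℝ × ℝ => (1 - p.2)⁻¹ • triangleKernel K (1 - p.1, p.2)) 2
      ((jacobiMeasure 1 0).prod (jacobiMeasure 1 0)) := by
  have h1 : MemLp (fun p : ℝ × ℝ => triangleKernel K (1 - p.1, p.2)) 2
      ((volume.restrict (Ioo (0 : ℝ) 1)).prod (volume.restrict (Ioo (0 : ℝ) 1))) :=
    (memLp_triangleKernel hK).comp_measurePreserving
      (measurePreserving_one_sub.prod (MeasurePreserving.id _))
  have h2 := aestronglyMeasurable_inv_smul h1.1
  have hsqrt : Measurable fun p : ℝ × ℝ => √(1 - p.2) := by fun_prop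
  have hac : (jacobiMeasure 1 0).prod (volume.restrict (Ioo (0 : ℝ) 1)) ≪
      (volume.restrict (Ioo (0 : ℝ) 1)).prod (volume.restrict (Ioo (0 : ℝ) 1)) :=
    (withDensity_absolutelyContinuous _ _).prod Measure.AbsolutelyContinuous.rfl
  refine memLp_prod_jacobiMeasure (h2.mono_ac hac) (memLp_jacobiMeasure_prod
    (hsqrt.aestronglyMeasurable.smul h2) (h1.of_le ?_ (ae_of_all _ fun p => ?_)))
  · have hsqrt' : Measurable fun p : ℝ × ℝ => √(1 - p.1) := by fun_prop
    exact AEStronglyMeasurable.smul (𝕜 := ℝ) hsqrt'.aestronglyMeasurable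
      (hsqrt.aestronglyMeasurable.smul h2)
  · rw [smul_smul √(1 - p.2), ← div_eq_mul_inv, Real.sqrt_div_self, smul_smul, norm_smul]
    -- On the support `y < x`, so the factor `√(1-x)/√(1-y)` left by the two weights is at most `1`.
    by_cases h : (1 - p.1, p.2) ∈ lowerTriangle
    · refine mul_le_of_le_one_left (norm_nonneg _) ?_
      have h' : p.2 < 1 - (1 - p.1) := h
      rw [Real.norm_of_nonneg (by positivity), ← div_eq_mul_inv]
      exact div_le_one_of_le₀ (Real.sqrt_le_sqrt (by linarith)) (Real.sqrt_nonneg _)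
    · rw [triangleKernel, indicator_of_notMem h]
      simp

/-! ### The three compact operators -/

/-- Input and output both carry `dx`, so the plain kernel needs no weight. The coefficient formula
applies because `(1-x) dx ≤ dx` puts `u` in the weighted space. -/
theorem exists_compact_volterraLQKE_L2 {K : ℝ → ℝ → 𝕜}
    (hK : MemLp (fun p : ℝ × ℝ => K (1 - p.1) p.2) 2 triangleMeasure) :
    ∃ V : Lp 𝕜 2 (volume.restrict (Ioo (0 : ℝ) 1)) →L[𝕜] lp (fun _ : ℕ => 𝕜) 2,
      (∀ u n, V u n = normalize 0 0 (volterraLQKE K (jacobiCoeff 1 0 u)) n) ∧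
      IsCompactOperator V := by
  obtain ⟨e, he⟩ := exists_hilbertBasis_legendre 𝕜
  have hk := memLp_triangleKernel hK
  refine ⟨e.repr.toContinuousLinearEquiv.toContinuousLinearMap.comp (kernelOperator hk),
    fun u n => ?_, (isCompactOperator_kernelOperator hk e).clm_comp _⟩
  change e.repr (kernelOperator hk u) n = _
  rw [he, volterraLQKE_jacobiCoeff hK ((Lp.memLp u).mono_measure jacobiMeasure_le)]
  congr 1
  refine jacobiCoeff_congr 0 0 ?_
  filter_upwards [kernelOperator_ae_eq hk u, ae_restrict_mem measurableSet_Ioo] with x h1 hx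
  rw [h1, ← setIntegral_indicator_Iio (sub_le_self 1 hx.1.le)]
  refine integral_congr_ae (ae_of_all _ fun y => ?_)
  simp only [triangleKernel_section]
  exact (indicator_mul_left _ _ _).symm

theorem unnormalize_repr {e : HilbertBasis ℕ 𝕜 (Lp 𝕜 2 (jacobiMeasure 1 0))}
    (he : ∀ u n, e.repr u n = normalize 1 0 (jacobiCoeff 1 0 u) n) (c : lp (fun _ : ℕ => 𝕜) 2) :
    unnormalize 1 0 c = jacobiCoeff 1 0 (e.repr.symm c) := by
  funext n
  have h := he (e.repr.symm c) n
  rw [LinearIsometryEquiv.apply_symm_apply] at h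
  rw [unnormalize, h, normalize, smul_smul, inv_mul_cancel₀ (jacobiNorm_one_ne n), one_smul]

theorem exists_compact_volterraLQKE {K : ℝ → ℝ → 𝕜}
    (hK : MemLp (fun p : ℝ × ℝ => K (1 - p.1) p.2) 2 triangleMeasure)
    (hK' : MemLp (fun p : ℝ × ℝ => ((√(1 - p.2))⁻¹ : ℝ) • K (1 - p.1) p.2) 2 triangleMeasure) :
    ∃ V : lp (fun _ : ℕ => 𝕜) 2 →L[𝕜] lp (fun _ : ℕ => 𝕜) 2,
      (∀ c n, V c n = normalize 0 0 (volterraLQKE K (unnormalize 1 0 c)) n) ∧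
      IsCompactOperator V := by
  obtain ⟨e, he⟩ := exists_hilbertBasis_legendre 𝕜
  obtain ⟨q, -, hq⟩ := exists_hilbertBasis_jacobi_one 𝕜
  have hk := memLp_weighted_triangleKernel hK hK'
  refine ⟨(e.repr.toContinuousLinearEquiv.toContinuousLinearMap.comp (kernelOperator hk)).comp
    q.repr.symm.toContinuousLinearEquiv.toContinuousLinearMap,
    fun c n => ?_, ((isCompactOperator_kernelOperator hk q).clm_comp _).comp_clm _⟩
  change e.repr (kernelOperator hk (q.repr.symm c)) n = _
  rw [he, unnormalize_repr hq, volterraLQKE_jacobiCoeff hK (Lp.memLp _)]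
  congr 1
  refine jacobiCoeff_congr 0 0 ?_
  filter_upwards [kernelOperator_ae_eq hk (q.repr.symm c), ae_restrict_mem measurableSet_Ioo]
    with x h1 hx
  rw [h1]
  exact integral_kernel_mul (sub_le_self 1 hx.1.le) _ _

theorem exists_compact_volterra {K : ℝ → ℝ → 𝕜}
    (hK : MemLp (fun p : ℝ × ℝ => K (1 - p.1) p.2) 2 triangleMeasure) :
    ∃ (E : Lp 𝕜 2 (jacobiMeasure 1 0) ≃ₗᵢ[𝕜] lp (fun _ : ℕ => 𝕜) 2)
        (T : Lp 𝕜 2 (jacobiMeasure 1 0) →L[𝕜] Lp 𝕜 2 (jacobiMeasure 1 0))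
        (V : lp (fun _ : ℕ => 𝕜) 2 →L[𝕜] lp (fun _ : ℕ => 𝕜) 2),
      (∀ u n, E u n = normalize 1 0 (jacobiCoeff 1 0 u) n) ∧
      (∀ u, ∀ᵐ x ∂(volume.restrict (Ioo (0 : ℝ) 1)),
        IntegrableOn (fun y => K x y * u y) (Ioo 0 x) ∧
        T u x = ∫ y in Ioo 0 x, K x y * u y) ∧
      (∀ c, V c = E (T (E.symm c))) ∧
      (∀ c n, V c n =
        normalize 1 0 (raising (reflect (volterraLQKE K (unnormalize 1 0 c)))) n) ∧
      IsCompactOperator V := by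
  obtain ⟨q, -, hq⟩ := exists_hilbertBasis_jacobi_one 𝕜
  have hk := memLp_reflected_triangleKernel hK
  have hT : ∀ u : Lp 𝕜 2 (jacobiMeasure 1 0), ∀ᵐ x ∂(volume.restrict (Ioo (0 : ℝ) 1)),
      IntegrableOn (fun y => K x y * u y) (Ioo 0 x) ∧
        kernelOperator hk u x = ∫ y in Ioo 0 x, K x y * u y := by
    intro u
    filter_upwards [restrict_Ioo_absolutelyContinuous.ae_le (kernelOperator_ae_eq hk u),
      restrict_Ioo_absolutelyContinuous.ae_le (ae_integrable_kernel_mul hk (Lp.memLp u)),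
      ae_restrict_mem measurableSet_Ioo] with x h1 h2 hx
    simp only [triangleKernel_section, sub_sub_cancel] at h2
    refine ⟨integrableOn_of_integrable_kernel_mul hx.2.le h2, h1.trans ?_⟩
    simp only [triangleKernel_section, sub_sub_cancel]
    exact integral_kernel_mul hx.2.le _ _
  refine ⟨q.repr, kernelOperator hk,
    (q.repr.toContinuousLinearEquiv.toContinuousLinearMap.comp (kernelOperator hk)).comp
      q.repr.symm.toContinuousLinearEquiv.toContinuousLinearMap,
    hq, hT, fun c => rfl, fun c n => ?_,
    ((isCompactOperator_kernelOperator hk q).clm_comp _).comp_clm _⟩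
  change q.repr (kernelOperator hk (q.repr.symm c)) n = _
  have hi := integrableOn_integral_triangle
    (integrable_kernel_mul hK (Lp.memLp (q.repr.symm c)))
  -- The double reflection is left unsimplified to match the output of `reflect_jacobiCoeff`.
  have hi' : IntegrableOn (fun x => ∫ y in Ioo 0 (1 - (1 - x)),
      K (1 - (1 - x)) y * q.repr.symm c y) (Ioo (0 : ℝ) 1) :=
    (measurePreserving_one_sub.integrable_comp hi.aestronglyMeasurable).2 hi
  rw [hq, unnormalize_repr hq, volterraLQKE_jacobiCoeff hK (Lp.memLp _), reflect_jacobiCoeff,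
    raising_jacobiCoeff hi']
  congr 1
  refine jacobiCoeff_congr 1 0 ?_
  filter_upwards [hT (q.repr.symm c)] with x hx
  rw [hx.2, sub_sub_cancel]

end VolterraJacobi

end

theorem mainTheorem4 {𝕜 : Type*} [RCLike 𝕜] (K : ℝ → ℝ → 𝕜)
    (hK : MemLp (fun p : ℝ × ℝ => K (1 - p.1) p.2) 2 VolterraJacobi.triangleMeasure) :
    -- the coefficient-space operator, brought back to the (1,0) basis, for every `L²` kernel
    (∃ (E : Lp 𝕜 2 (VolterraJacobi.jacobiMeasure 1 0) ≃ₗᵢ[𝕜] lp (fun _ : ℕ => 𝕜) 2)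
        (T : Lp 𝕜 2 (VolterraJacobi.jacobiMeasure 1 0) →L[𝕜]
          Lp 𝕜 2 (VolterraJacobi.jacobiMeasure 1 0))
        (V : lp (fun _ : ℕ => 𝕜) 2 →L[𝕜] lp (fun _ : ℕ => 𝕜) 2),
      (∀ u n, E u n =
        VolterraJacobi.normalize 1 0 (VolterraJacobi.jacobiCoeff 1 0 u) n) ∧
      (∀ u, ∀ᵐ x ∂(volume.restrict (Ioo (0 : ℝ) 1)),
        IntegrableOn (fun y => K x y * u y) (Ioo 0 x) ∧
        T u x = ∫ y in Ioo 0 x, K x y * u y) ∧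
      (∀ c, V c = E (T (E.symm c))) ∧
      (∀ c n, V c n =
        VolterraJacobi.normalize 1 0 (VolterraJacobi.raising (VolterraJacobi.reflect
          (VolterraJacobi.volterraLQKE K (VolterraJacobi.unnormalize 1 0 c)))) n) ∧
      IsCompactOperator V) ∧
    -- the product `L Q K E` on the coefficients of functions in `L²(0,1)`, for every `L²` kernel
    (∃ V : Lp 𝕜 2 (volume.restrict (Ioo (0 : ℝ) 1)) →L[𝕜] lp (fun _ : ℕ => 𝕜) 2,
      (∀ u n, V u n =
        VolterraJacobi.normalize 0 0
          (VolterraJacobi.volterraLQKE K (VolterraJacobi.jacobiCoeff 1 0 u)) n) ∧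
      IsCompactOperator V) ∧
    -- the product `L Q K E` on all of `ℓ²`
    (MemLp (fun p : ℝ × ℝ => ((√(1 - p.2))⁻¹ : ℝ) • K (1 - p.1) p.2) 2
        VolterraJacobi.triangleMeasure →
      ∃ V : lp (fun _ : ℕ => 𝕜) 2 →L[𝕜] lp (fun _ : ℕ => 𝕜) 2,
        (∀ c n, V c n =
          VolterraJacobi.normalize 0 0
            (VolterraJacobi.volterraLQKE K (VolterraJacobi.unnormalize 1 0 c)) n) ∧
        IsCompactOperator V) := by
  exact ⟨VolterraJacobi.exists_compact_volterra hK,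
    VolterraJacobi.exists_compact_volterraLQKE_L2 hK,
    VolterraJacobi.exists_compact_volterraLQKE hK⟩
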